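/- **Setting.** Let $n\ge 1$. Let $Q$ be a finite-dimensional smooth manifold and, for $0\le i\le n-1$, let $U_i$ be a smooth manifold which is an (embedded) submanifold of some $\mathbb R^{k_i}$, let $\mathbb U_i\subseteq U_i$ be closed, let $F_i:Q\times U_i\to Q$ be $C^1$, and let $\ell:Q\to\mathbb R$ and $L_i:Q\times U_i\to\mathbb R$ be locally Lipschitz. Fix $q_0\in Q$. A control sequence $\mathbf u=(u_i)_{i=0}^{n-1}\in\mathcal U:=\prod_i\mathbb U_i$ determines a state sequence by $q_{i+1}=F_i(q_i,u_i)$, $0\le i\le n-1$, and the cost $$J(\mathbf u)=\ell(q_n)+\sum_{i=0}^{n-1}L_i(q_i,u_i).$$ For a locally Lipschitz function $g$ on a manifold $M$, a covector $p\in T_x^*M$ is a Fréchet subgradient of $g$ at $x$ if there is a $C^1$ function $h:M\to\mathbb R$ with $p=dh(x)$ such that $g-h$ has a local minimum at $x$. The limiting subdifferential $\partial_Lg(x)$ is the set of all $p\in T^*_xM$ that are limits, in $T^*M$, of Fréchet subgradients $p_j$ of $g$ at points $x_j$ with $x_j\to x$ and $g(x_j)\to g(x)$. **Assumptions (A).**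 There are a smooth vector bundle $\pi:X\to Q$ of finite rank, a $C^1$ map $E:X\to Q$ and maps $f_i:Q\times U_i\to X$ with $f_i(q,u)\in X_q:=\pi^{-1}(q)$ and $F_i=E\circ f_i$. The sets $\mathbb U_i$ are convex as subsets of $\mathbb R^{k_i}$, and for each fixed $q\in Q$ the map $u\mapsto f_i(q,u)\in X_q$ is affine on $\mathbb U_i$ and the function $u\mapsto L_i(q,u)$ is convex on $\mathbb U_i$. For $v,w\in X_q$ write $\mathbb FE_v(w)=\frac{d}{dt}\big|_{t=0}E(v+tw)\in T_{E(v)}Q$ for the fibre derivative of $E$. **Theorem.** Suppose that $\mathbf u\in\mathcal U$ is a local minimizer of $J$ on $\mathcal U$, with state sequence $(q_i)_{i=0}^n$. Then there are covectors $a_i\in T^*_{q_i}Q$ $(1\le i\le n)$ and $b_i\in T^*_{u_i}U_i$ $(0\le i\le n-1)$ with $$a_n\in\partial_L\ell(q_n),\qquad (a_i,b_i)\in\partial_LL_i(q_i,u_i)\ (1\le i\le n-1),\qquad b_0\in\partial_L\big(L_0(q_0,\cdot)\big)(u_0),$$ such that the costates $p_i\in T^*_{q_i}Q$ $(1\le i\le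 n)$ defined by $$p_n=-a_n,\qquad p_{i-1}=-a_{i-1}+D_qF_{i-1}(q_{i-1},u_{i-1})^*p_i\quad(2\le i\le n)$$ satisfy the maximum principle $$H_i(u_i,p_{i+1})=\max_{u\in\mathbb U_i}H_i(u,p_{i+1})\qquad(0\le i\le n-1),$$ where, for $u\in\mathbb U_i$ and $p\in T^*_{q_{i+1}}Q$, $$H_i(u,p)=\big\langle \mathbb FE_{f_i(q_i,u_i)}^*\,p,\ f_i(q_i,u)\big\rangle-L_i(q_i,u).$$ -/

import Mathlib

open scoped Manifold ContDiff Topology Bundle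

noncomputable section

namespace DiscretePMP

section NonsmoothAnalysis

variable {E : Type*} [NormedAddCommGroup E] [NormedSpace ℝ E]
  {H : Type*} [TopologicalSpace H] (I : ModelWithCorners ℝ E H)
  {M : Type*} [TopologicalSpace M] [ChartedSpace H M]

/-- The cotangent space `T*_x M`. -/
abbrev Cotangent (x : M) : Type _ := TangentSpace I x →L[ℝ] ℝ

/-- `f : M → ℝ` is locally Lipschitz at `x`: there is a smooth chart `φ` whose domain contains `x`
such that `f ∘ φ⁻¹` is Lipschitz on the image of `φ`. -/
def LocLipschitzAt (f : M → ℝ) (x : M) : Prop :=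
  ∃ φ ∈ IsManifold.maximalAtlas I ∞ M, x ∈ φ.source ∧
    ∃ K : NNReal, LipschitzOnWith K (f ∘ (φ.extend I).symm) (φ.extend I).target

/-- `f : M → ℝ` is locally Lipschitz. -/
def LocLipschitz (f : M → ℝ) : Prop := ∀ x, LocLipschitzAt I f x

/-- The Fréchet subdifferential of `f` at `x`: covectors `p = dg(x)` with `g : M → ℝ` of class
`C^1` such that `f - g` has a local minimum at `x`. -/
def frechetSubdiff (f : M → ℝ) (x : M) : Set (Cotangent I x) :=
  {p | ∃ g : M → ℝ, ContMDiff I 𝓘(ℝ, ℝ) 1 g ∧ p = mfderiv I 𝓘(ℝ, ℝ) g x ∧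
    IsLocalMin (fun y => f y - g y) x}

variable [IsManifold I ∞ M]

/-- A covector at `x` as a point of the total space of the cotangent bundle `T*M`. -/
def toCotangentBundle (x : M) (p : Cotangent I x) :
    Bundle.TotalSpace (E →L[ℝ] ℝ) (fun y : M => TangentSpace I y →L[ℝ] ℝ) := ⟨x, p⟩

/-- The limiting subdifferential of `f` at `x`: limits in `T*M` of Fréchet subgradients
`pₖ ∈ ∂_F f(xₖ)` with `xₖ → x` and `f(xₖ) → f(x)`. -/
def limitingSubdiff (f : M → ℝ) (x : M) : Set (Cotangent I x) :=
  {p | ∃ (y : ℕ → M) (r : ∀ k, Cotangent I (y k)),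
    (∀ k, r k ∈ frechetSubdiff I f (y k)) ∧
    Filter.Tendsto y Filter.atTop (𝓝 x) ∧
    Filter.Tendsto (fun k => f (y k)) Filter.atTop (𝓝 (f x)) ∧
    Filter.Tendsto (fun k => toCotangentBundle I (y k) (r k)) Filter.atTop
      (𝓝 (toCotangentBundle I x p))}

end NonsmoothAnalysis

section Product

variable {E : Type*} [NormedAddCommGroup E] [NormedSpace ℝ E]
  {H : Type*} [TopologicalSpace H] (I : ModelWithCorners ℝ E H)
  {M : Type*} [TopologicalSpace M] [ChartedSpace H M]
  {E' : Type*} [NormedAddCommGroup E'] [NormedSpace ℝ E']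
  {H' : Type*} [TopologicalSpace H'] (J : ModelWithCorners ℝ E' H')
  {N : Type*} [TopologicalSpace N] [ChartedSpace H' N]

/-- The covector `(a, b) : (v, w) ↦ ⟨a, v⟩ + ⟨b, w⟩` on the product `M × N`, that is, the sum of the
pullbacks of `a` and `b` along the two projections. -/
def pairCovector (x : M) (y : N) (a : Cotangent I x) (b : Cotangent J y) :
    Cotangent (I.prod J) (x, y) :=
  a.comp (mfderiv (I.prod J) I (Prod.fst : M × N → M) (x, y)) +
    b.comp (mfderiv (I.prod J) J (Prod.snd : M × N → N) (x, y))

end Product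

section FibreDerivative

variable {E : Type*} [NormedAddCommGroup E] [NormedSpace ℝ E]
  {H : Type*} [TopologicalSpace H] (I : ModelWithCorners ℝ E H)
  {M : Type*} [TopologicalSpace M] [ChartedSpace H M]
  {Q : Type*} {V : Type*} {X : Q → Type*}
  [∀ q, AddCommGroup (X q)] [∀ q, Module ℝ (X q)]

/-- The fibre derivative at `v ∈ X_q` of a map `Φ : X → M` on the total space of a vector bundle:
`𝔽Φ_v(w) = d/dt|_{t=0} Φ(v + t w) ∈ T_{Φ(v)} M`. The curve is at `Φ(v + 0 w) = Φ(v)` for `t = 0`. -/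
def fibreDeriv (Φ : Bundle.TotalSpace V X → M) {q : Q} (v w : X q) :
    TangentSpace I (Φ ⟨q, v⟩) :=
  (mfderiv 𝓘(ℝ, ℝ) I (fun t : ℝ => Φ ⟨q, v + t • w⟩) 0 : ℝ →L[ℝ] E) (1 : ℝ)

/-- The pullback of `p ∈ T*_{Φ(v)} M` by the fibre derivative: `⟨𝔽Φ_v^* p, w⟩ = ⟨p, 𝔽Φ_v(w)⟩`. -/
def fibrePullback (Φ : Bundle.TotalSpace V X → M) {q : Q} (v : X q)
    (p : Cotangent I (Φ ⟨q, v⟩)) (w : X q) : ℝ :=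
  p (fibreDeriv I Φ v w)

end FibreDerivative

section Convexity

variable {U W A : Type*} [AddCommGroup W] [Module ℝ W] [AddCommGroup A] [Module ℝ A]

/-- With `U` regarded as a subset of the vector space `W` through `ι`, the map `f` is affine on
`S ⊆ U`. -/
def AffineOnVia (ι : U → W) (S : Set U) (f : U → A) : Prop :=
  ∀ u ∈ S, ∀ v ∈ S, ∀ w ∈ S, ∀ s t : ℝ, 0 ≤ s → 0 ≤ t → s + t = 1 →
    ι w = s • ι u + t • ι v → f w = s • f u + t • f v

/-- With `U` regarded as a subset of the vector space `W` through `ι`, the function `g` is convex on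
`S ⊆ U`. -/
def ConvexOnVia (ι : U → W) (S : Set U) (g : U → ℝ) : Prop :=
  ∀ u ∈ S, ∀ v ∈ S, ∀ w ∈ S, ∀ s t : ℝ, 0 ≤ s → 0 ≤ t → s + t = 1 →
    ι w = s • ι u + t • ι v → g w ≤ s * g u + t * g v

end Convexity

section ControlSystem

variable {n : ℕ} {Q : Type*} {U : Fin n → Type*}

/-- The state sequence `q_0, …, q_n` generated from `q_0` by the controls `u_0, …, u_{n-1}` through
`q_{i+1} = F_i(q_i, u_i)`. -/
def stateSeq (F : ∀ i, Q × U i → Q) (q₀ : Q) (u : ∀ i, U i) : Fin (n + 1) → Q :=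
  Fin.induction q₀ (fun i q => F i (q, u i))

/-- The cost `J(u) = ℓ(q_n) + ∑_{i<n} L_i(q_i, u_i)`. -/
def cost (F : ∀ i, Q × U i → Q) (q₀ : Q) (ℓ : Q → ℝ) (L : ∀ i, Q × U i → ℝ) (u : ∀ i, U i) : ℝ :=
  ℓ (stateSeq F q₀ u (Fin.last n)) +
    ∑ i : Fin n, L i (stateSeq F q₀ u i.castSucc, u i)

/-- The set `𝒰` of control sequences `u` with `u_i ∈ 𝕌_i` for all `i`. -/
def admissible (S : ∀ i, Set (U i)) : Set (∀ i, U i) := {u | ∀ i, u i ∈ S i}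

theorem stateSeq_succ (F : ∀ i, Q × U i → Q) (q₀ : Q) (u : ∀ i, U i) (i : Fin n) :
    stateSeq F q₀ u i.succ = F i (stateSeq F q₀ u i.castSucc, u i) := rfl

end ControlSystem

end DiscretePMP

end

/-! In coordinates the problem is to minimize `ℓ(z_n) + ∑ L_i(z_i, y_i)` under the constraints
`z_{i+1} = F_i(z_i, y_i)`, `y_i ∈ A_i`. States and controls are treated as independent variables,
and `N ∑ ‖z_j - T_j‖²` penalizes the defects, where `T_0` is the initial state and `T_{i+1} =
F_i(z_i, y_i)`. Added quadratic terms make the given process the only minimizer among nearby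
feasible ones, so for a suitable `N` the penalized problem has a minimizer close to it
(`exists_penalized_minimizer`).

At that minimizer `z_n`, or a single pair `(z_i, y_i)`, can be varied alone. Each variation involves
one nonsmooth function plus smooth terms, so no nonsmooth sum or chain rule is needed. With `p_j =
2N⟨z_j - T_j, ·⟩`, `ℓ` has a subgradient close to `-p_n`, and `L_i` has a subgradient relative to
`A_i` close to `p_{i+1} ∘ DF_i - (p_i, 0)` (`exists_approx_costates`). Lipschitz bounds, propagated
backwards from `p_n`, make the costates bounded, and a convergent subsequence gives the adjoint
recursion (`exists_costates`).

The maximum principle comes from convexity: a subgradient relative to `A_i`, tested in the direction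
`w - y_i`, is at most `L_i(z_i, w) - L_i(z_i, y_i)` (`locSubgrad_le_of_convexOn`), and this survives
the limit. As `f_i` is affine in the control, the derivative of `F_i = Φ ∘ f_i` towards `w` is the
fibre derivative of `Φ` along `f_i(w) - f_i(u_i)`, so the inequality compares Hamiltonians
(`isMaxOn_fibrePullback_sub`).

The limiting subdifferential requires subgradients without constraint. A second penalization, of the
control constraint, acts on the control variable only and hence hardly changes the state component
of the subgradient (`exists_locSubgrad_univ_near`). The control components stay bounded, and any
accumulation point serves as `b_i`, which does not occur in the maximum principle.

Convexity is given in the ambient Euclidean space and smoothness in charts. Controls are therefore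
kept in ambient coordinates, with `F_i` and `L_i` extended through a smooth extension `σ` of the
chart. -/

namespace DiscretePMP

open Filter Set

/-! ### Subgradients relative to a set, and their bounds -/

section LocalSubgradients

variable {Y : Type*} [NormedAddCommGroup Y] [NormedSpace ℝ Y]

/-- Local `C^1` subgradients of `g` relative to the set `S`: derivatives at `y` of functions `h` that
are `C^1` at `y` and such that `g - h` has a local minimum on `S` at `y`. -/
def locSubgrad (g : Y → ℝ) (S : Set Y) (y : Y) : Set (Y →L[ℝ] ℝ) :=
  {ξ | ∃ h : Y → ℝ, ContDiffAt ℝ 1 h y ∧ fderiv ℝ h y = ξ ∧ IsLocalMinOn (fun x => g x - h x) S y}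

theorem fderiv_apply_le_of_eventually {h : Y → ℝ} {y v : Y} {c : ℝ}
    (hd : DifferentiableAt ℝ h y) (hv : ∀ᶠ t : ℝ in 𝓝[>] 0, h (y + t • v) - h y ≤ t * c) :
    fderiv ℝ h y v ≤ c := by
  have h1 : HasDerivAt (fun t : ℝ => h (y + t • v)) (fderiv ℝ h y v) 0 :=
    (hd.hasFDerivAt.hasLineDerivAt v)
  have h2 := h1.tendsto_slope_zero_right
  refine le_of_tendsto h2 ?_
  filter_upwards [hv, self_mem_nhdsWithin] with t ht ht0
  have ht0 : 0 < t := ht0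
  simp only [zero_add, zero_smul, add_zero, smul_eq_mul]
  rw [inv_mul_le_iff₀ ht0]
  exact ht

theorem tendsto_add_smul_nhdsGT (y v : Y) :
    Tendsto (fun t : ℝ => y + t • v) (𝓝[>] 0) (𝓝 y) := by
  have : Tendsto (fun t : ℝ => y + t • v) (𝓝 0) (𝓝 (y + (0 : ℝ) • v)) :=
    Continuous.tendsto (by fun_prop) 0
  rw [zero_smul, add_zero] at this
  exact this.mono_left nhdsWithin_le_nhds

/-- A subgradient is bounded along directions in which the function is Lipschitz. -/
theorem locSubgrad_apply_le {g : Y → ℝ} {S : Set Y} {y v : Y} {ξ : Y →L[ℝ] ℝ}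
    (hξ : ξ ∈ locSubgrad g S y) {c : ℝ} (hS : ∀ᶠ t : ℝ in 𝓝[>] 0, y + t • v ∈ S)
    (hg : ∀ᶠ t : ℝ in 𝓝[>] 0, g (y + t • v) - g y ≤ t * c) : ξ v ≤ c := by
  obtain ⟨h, hC, rfl, hmin⟩ := hξ
  refine fderiv_apply_le_of_eventually (hC.differentiableAt one_ne_zero) ?_
  have h1 := (eventually_nhdsWithin_iff.1 hmin)
  filter_upwards [(tendsto_add_smul_nhdsGT y v).eventually h1, hS, hg] with t h1 h2 h3
  have := h1 h2
  linarith

/-- Convexity keeps the segment from `x` to `w` in `A` and bounds the difference quotients of `L`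
along it. This replaces any appeal to normal cones, and the resulting inequality is stable under
limits in `(z, x)`. -/
theorem locSubgrad_le_of_convexOn {Z X : Type*} [NormedAddCommGroup Z] [NormedSpace ℝ Z]
    [NormedAddCommGroup X] [NormedSpace ℝ X] {L : Z × X → ℝ} {A : Set X} {z : Z} {x w : X}
    (hL : ConvexOn ℝ A (fun x => L (z, x))) (hx : x ∈ A) (hw : w ∈ A)
    {ξ : Z × X →L[ℝ] ℝ} (hξ : ξ ∈ locSubgrad L {y | y.2 ∈ A} (z, x)) :
    ξ (0, w - x) ≤ L (z, w) - L (z, x) := by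
  have hlt : ∀ᶠ t : ℝ in 𝓝[>] 0, t < 1 :=
    nhdsWithin_le_nhds (eventually_lt_nhds zero_lt_one)
  have key : ∀ t : ℝ, x + t • (w - x) = (1 - t) • x + t • w := fun t => by module
  refine locSubgrad_apply_le hξ ?_ ?_
  · filter_upwards [hlt, self_mem_nhdsWithin] with t ht ht0
    have ht0 : 0 < t := ht0
    change x + t • (w - x) ∈ A
    rw [key]
    exact hL.1 hx hw (by linarith) ht0.le (by ring)
  · filter_upwards [hlt, self_mem_nhdsWithin] with t ht ht0
    have ht0 : 0 < t := ht0
    have := hL.2 hx hw (sub_nonneg.2 ht.le) ht0.le (by ring)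
    simp only [Prod.smul_mk, smul_zero, Prod.mk_add_mk, add_zero, key]
    simp only [smul_eq_mul] at this
    linarith

/-- The range of `T` consists of directions that the constraint leaves free, so the Lipschitz
estimate applies to both `v` and `-v`. It is used with the identity when there is no constraint and
with `inl` when only the control is constrained. -/
theorem locSubgrad_norm_comp_le {Z : Type*} [NormedAddCommGroup Z] [NormedSpace ℝ Z]
    {g : Y → ℝ} {S : Set Y} {y : Y} {ξ : Y →L[ℝ] ℝ}
    (hξ : ξ ∈ locSubgrad g S y) (T : Z →L[ℝ] Y) (hT : ∀ v, ‖T v‖ ≤ ‖v‖)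
    (hS : ∀ v, ∀ t : ℝ, y + t • T v ∈ S) {K : NNReal} {s : Set Y} (hs : s ∈ 𝓝 y)
    (hg : LipschitzOnWith K g s) : ‖ξ.comp T‖ ≤ K := by
  have hle : ∀ v, ξ (T v) ≤ K * ‖v‖ := by
    intro v
    refine locSubgrad_apply_le hξ (Eventually.of_forall (hS v)) ?_
    filter_upwards [(tendsto_add_smul_nhdsGT y (T v)).eventually hs, self_mem_nhdsWithin]
      with t ht ht0
    have ht0 : 0 < t := ht0
    have h1 := hg.dist_le_mul _ ht _ (mem_of_mem_nhds hs)
    rw [Real.dist_eq, dist_eq_norm, add_sub_cancel_left, norm_smul, Real.norm_of_nonneg ht0.le] at h1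
    calc g (y + t • T v) - g y ≤ K * (t * ‖T v‖) := (le_abs_self _).trans h1
      _ ≤ K * (t * ‖v‖) := by gcongr; exact hT v
      _ = t * (K * ‖v‖) := by ring
  refine ContinuousLinearMap.opNorm_le_bound _ K.2 fun v => ?_
  rw [Real.norm_eq_abs, abs_le]
  constructor
  · have := hle (-v)
    rw [map_neg, map_neg, norm_neg] at this
    simp only [ContinuousLinearMap.comp_apply]
    linarith!
  · exact hle v

end LocalSubgradients

/-! ### Penalization on a compact set -/

section Penalty

/-- Away from `x₀` either `P > 0`, and a large `N` lifts the value above `g x₀`, or `P = 0`, and `g`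
itself exceeds `g x₀`. Compactness of the complement of `V` yields one `N` for all such points, so a
minimizer over `C` must lie in `V`. -/
theorem exists_penalized_minimizer {K : Type*} [TopologicalSpace K] {C : Set K} (hC : IsCompact C)
    {g P : K → ℝ} (hg : ContinuousOn g C) (hP : ContinuousOn P C) (hP0 : ∀ x ∈ C, 0 ≤ P x)
    {x₀ : K} (hx₀ : x₀ ∈ C) (hPx₀ : P x₀ = 0)
    (hmin : ∀ x ∈ C, P x = 0 → g x ≤ g x₀ → x = x₀) {V : Set K} (hV : V ∈ 𝓝 x₀) :
    ∃ N : ℝ, ∃ x ∈ C, x ∈ V ∧ ∀ y ∈ C, g x + N * P x ≤ g y + N * P y := by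
  have hC' : IsCompact (C \ interior V) := hC.diff isOpen_interior
  have key : ∃ N : ℝ, ∀ x ∈ C \ interior V, g x₀ < g x + N * P x := by
    -- It suffices to find `N` locally: as `P ≥ 0` on `C`, the larger of two constants serves for a
    -- union.
    refine hC'.induction_on (p := fun s => ∃ N : ℝ, ∀ x ∈ s ∩ C, g x₀ < g x + N * P x) ?_ ?_ ?_ ?_
      |>.imp fun N h x hx => h x ⟨hx, hx.1⟩
    · simp
    · rintro s t hst ⟨N, h⟩
      exact ⟨N, fun x hx => h x ⟨hst hx.1, hx.2⟩⟩
    · rintro s t ⟨N, h⟩ ⟨N', h'⟩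
      refine ⟨max N N', fun x hx => ?_⟩
      rcases hx with ⟨hx | hx, hxC⟩
      · have h1 := h x ⟨hx, hxC⟩
        have h2 := mul_le_mul_of_nonneg_right (le_max_left N N') (hP0 x hxC)
        linarith
      · have h1 := h' x ⟨hx, hxC⟩
        have h2 := mul_le_mul_of_nonneg_right (le_max_right N N') (hP0 x hxC)
        linarith
    · intro x hx
      have hne : x ≠ x₀ := fun h => hx.2 (h ▸ mem_interior_iff_mem_nhds.2 hV)
      obtain ⟨N, hN⟩ : ∃ N : ℝ, g x₀ < g x + N * P x := by
        rcases (hP0 x hx.1).eq_or_lt with h | h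
        · refine ⟨0, ?_⟩
          rw [zero_mul, add_zero]
          by_contra! hle
          exact hne (hmin x hx.1 h.symm hle)
        · refine ⟨(g x₀ - g x + 1) / P x, ?_⟩
          rw [div_mul_cancel₀ _ h.ne']
          linarith
      have hc : ContinuousWithinAt (fun x => g x + N * P x) C x :=
        (hg x hx.1).add (continuousWithinAt_const.mul (hP x hx.1))
      have hev := hc.mono (sdiff_subset (t := interior V)) (Ioi_mem_nhds hN)
      exact ⟨_, hev, N, fun y hy => hy.1⟩
  obtain ⟨N, hN⟩ := key
  obtain ⟨x, hxC, hx⟩ := hC.exists_isMinOn ⟨x₀, hx₀⟩ (hg.add (continuousOn_const (c := N) |>.mul hP))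
  refine ⟨N, x, hxC, ?_, fun y hy => hx hy⟩
  by_contra hxV
  have h1 := hN x ⟨hxC, fun h => hxV (interior_subset h)⟩
  have h2 : g x + N * P x ≤ g x₀ + N * P x₀ := hx hx₀
  rw [hPx₀, mul_zero, add_zero] at h2
  linarith

end Penalty

section NormSq

variable {Y W : Type*} [NormedAddCommGroup Y] [NormedSpace ℝ Y]
  [NormedAddCommGroup W] [InnerProductSpace ℝ W]

/-- The derivative of `x ↦ ‖x‖ ^ 2` at `w`. -/
noncomputable def sqDeriv (w : W) : W →L[ℝ] ℝ := (2 : ℝ) • innerSL ℝ w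

theorem norm_sqDeriv_le (w : W) : ‖sqDeriv w‖ ≤ 2 * ‖w‖ := by
  rw [sqDeriv, norm_smul, innerSL_apply_norm]
  simp

theorem hasFDerivAt_norm_sub_sq {f : Y → W} {f' : Y →L[ℝ] W} {y : Y} (hf : HasFDerivAt f f' y)
    (c : W) : HasFDerivAt (fun x => ‖f x - c‖ ^ 2) ((sqDeriv (f y - c)).comp f') y := by
  have := (hf.sub_const c).norm_sq
  rw [sqDeriv]
  convert this using 1
  ext v
  simp
end NormSq

/-! ### Removing the control constraint from a subgradient -/

section Unconstrain

variable {Z X W : Type*} [NormedAddCommGroup Z] [InnerProductSpace ℝ Z] [FiniteDimensional ℝ Z]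
  [NormedAddCommGroup X] [InnerProductSpace ℝ X] [FiniteDimensional ℝ X]
  [NormedAddCommGroup W] [InnerProductSpace ℝ W]

/-- A subgradient relative to a constraint on the second variable is approximated, in its first
component, by unconstrained subgradients at nearby points. -/
theorem exists_locSubgrad_univ_near {L : Z × X → ℝ} {G : X → W} {A : Set W} (hA : IsCompact A)
    {y₀ : Z × X} (hG : ContDiffAt ℝ 1 G y₀.2) (hGA : G y₀.2 ∈ A)
    (hL : ∀ᶠ y in 𝓝 y₀, ContinuousAt L y) {ξ : Z × X →L[ℝ] ℝ}
    (hξ : ξ ∈ locSubgrad L {y | G y.2 ∈ A} y₀) {ε : ℝ} (hε : 0 < ε) :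
    ∃ y, dist y y₀ < ε ∧ ∃ η ∈ locSubgrad L univ y,
      ‖η.comp (ContinuousLinearMap.inl ℝ Z X) - ξ.comp (ContinuousLinearMap.inl ℝ Z X)‖ < ε := by
  obtain ⟨h, hC, rfl, hmin⟩ := hξ
  have e1 : ∀ᶠ y in 𝓝 y₀, ContDiffAt ℝ 1 h y := hC.eventually (by simp)
  have e2 : ∀ᶠ y in 𝓝 y₀, ContDiffAt ℝ 1 G y.2 :=
    continuousAt_snd.eventually (hG.eventually (by simp))
  have e3 : ∀ᶠ y in 𝓝 y₀, ‖(fderiv ℝ h y).comp (ContinuousLinearMap.inl ℝ Z X) -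
      (fderiv ℝ h y₀).comp (ContinuousLinearMap.inl ℝ Z X)‖ < ε / 2 := by
    have hc : ContinuousAt (fun y => (fderiv ℝ h y).comp (ContinuousLinearMap.inl ℝ Z X)) y₀ :=
      (hC.continuousAt_fderiv one_ne_zero).clm_comp continuousAt_const
    have := Metric.continuousAt_iff'.1 hc (ε / 2) (half_pos hε)
    simpa only [dist_eq_norm] using this
  have e4 := eventually_nhdsWithin_iff.1 hmin
  obtain ⟨r₀, hr₀, hball⟩ := Metric.eventually_nhds_iff.1 (hL.and (e1.and (e2.and (e3.and e4))))
  set r : ℝ := min (r₀ / 2) (ε / 8) with hr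
  have hrpos : 0 < r := lt_min (half_pos hr₀) (by positivity)
  have hin : ∀ y ∈ Metric.closedBall y₀ r, dist y y₀ < r₀ := fun y hy =>
    lt_of_le_of_lt (hy.trans (min_le_left _ _)) (half_lt_self hr₀)
  have hnear : Metric.ball y₀ r ∈ 𝓝 y₀ := Metric.ball_mem_nhds _ hrpos
  -- The point `s ∈ A` is an additional variable, so `‖G y.2 - s‖²` penalizes the constraint without
  -- a projection onto `A`. The quadratic terms make `y₀` the strict minimizer among feasible
  -- points.
  set g : (Z × X) × W → ℝ := fun p => L p.1 - h p.1 + (‖p.1.1 - y₀.1‖ ^ 2 + ‖p.1.2 - y₀.2‖ ^ 2)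
    with hg
  set P : (Z × X) × W → ℝ := fun p => ‖G p.1.2 - p.2‖ ^ 2 with hP
  have hcomp : IsCompact (Metric.closedBall y₀ r ×ˢ A) := (isCompact_closedBall _ _).prod hA
  obtain ⟨N, ⟨y, s⟩, ⟨hyC, hsA⟩, hyV, hymin⟩ :=
    exists_penalized_minimizer (g := g) (P := P) (x₀ := (y₀, G y₀.2)) hcomp
      (by
        rintro ⟨y, s⟩ ⟨hy, -⟩
        obtain ⟨h1, h2, -⟩ := hball (hin y hy)
        refine ContinuousAt.continuousWithinAt ?_
        refine ContinuousAt.add (ContinuousAt.sub ?_ ?_) (by fun_prop)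
        · exact ContinuousAt.comp (f := Prod.fst) (x := (y, s)) h1 continuousAt_fst
        · exact ContinuousAt.comp (f := Prod.fst) (x := (y, s)) h2.continuousAt continuousAt_fst)
      (by
        rintro ⟨y, s⟩ ⟨hy, -⟩
        obtain ⟨-, -, h3, -⟩ := hball (hin y hy)
        refine ContinuousAt.continuousWithinAt ?_
        refine ((ContinuousAt.sub ?_ continuousAt_snd).norm).pow 2
        exact ContinuousAt.comp (f := fun p : (Z × X) × W => p.1.2) (x := (y, s))
          h3.continuousAt (by fun_prop))
      (fun _ _ => by positivity) ⟨Metric.mem_closedBall_self hrpos.le, hGA⟩ (by simp [hP])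
      (by
        rintro ⟨y, s⟩ ⟨hy, hs⟩ hPy hgy
        have hs' : G y.2 = s := by
          simpa [hP, sub_eq_zero] using hPy
        obtain ⟨-, -, -, -, h5⟩ := hball (hin y hy)
        have h6 := h5 (by simpa [hs'] using hs)
        simp only [hg, sub_self, norm_zero] at hgy
        have h7 : ‖y.1 - y₀.1‖ ^ 2 + ‖y.2 - y₀.2‖ ^ 2 ≤ 0 := by
          norm_num at hgy
          linarith
        have h8 : y.1 = y₀.1 := by
          have : ‖y.1 - y₀.1‖ ^ 2 = 0 := by nlinarith [sq_nonneg ‖y.1 - y₀.1‖, sq_nonneg ‖y.2 - y₀.2‖]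
          simpa [sub_eq_zero] using this
        have h9 : y.2 = y₀.2 := by
          have : ‖y.2 - y₀.2‖ ^ 2 = 0 := by nlinarith [sq_nonneg ‖y.1 - y₀.1‖, sq_nonneg ‖y.2 - y₀.2‖]
          simpa [sub_eq_zero] using this
        have h10 : y = y₀ := Prod.ext h8 h9
        rw [← hs', h10])
      (V := Metric.ball y₀ r ×ˢ univ) (prod_mem_nhds hnear univ_mem)
  have hyb : y ∈ Metric.ball y₀ r := hyV.1
  have hyr : dist y y₀ < r := hyb
  obtain ⟨h1, h2, h3, h4, -⟩ := hball (hin y hyC)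
  refine ⟨y, hyr.trans_le ((min_le_right _ _).trans (by linarith)), ?_⟩
  -- Freezing `s` at its optimal value turns the joint minimum into an unconstrained local minimum
  -- of `L - k`.
  set k : Z × X → ℝ := fun x => h x - (‖x.1 - y₀.1‖ ^ 2 + ‖x.2 - y₀.2‖ ^ 2) - N * ‖G x.2 - s‖ ^ 2
    with hk
  have hGd : HasFDerivAt (fun x : Z × X => G x.2)
      ((fderiv ℝ G y.2).comp (ContinuousLinearMap.snd ℝ Z X)) y :=
    (h3.differentiableAt one_ne_zero).hasFDerivAt.comp y hasFDerivAt_snd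
  have hkd : HasFDerivAt k (fderiv ℝ h y -
      ((sqDeriv (y.1 - y₀.1)).comp (ContinuousLinearMap.fst ℝ Z X) +
        (sqDeriv (y.2 - y₀.2)).comp (ContinuousLinearMap.snd ℝ Z X)) -
      N • (sqDeriv (G y.2 - s)).comp
        ((fderiv ℝ G y.2).comp (ContinuousLinearMap.snd ℝ Z X))) y :=
    ((h2.differentiableAt one_ne_zero).hasFDerivAt.sub
      ((hasFDerivAt_norm_sub_sq hasFDerivAt_fst _).add
        (hasFDerivAt_norm_sub_sq hasFDerivAt_snd _))).sub
      ((hasFDerivAt_norm_sub_sq hGd s).const_mul N)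
  have hkC : ContDiffAt ℝ 1 k y := by
    refine (h2.sub (ContDiffAt.add ?_ ?_)).sub (contDiffAt_const.mul ?_)
    · exact ((contDiffAt_fst.sub contDiffAt_const).norm_sq ℝ)
    · exact ((contDiffAt_snd.sub contDiffAt_const).norm_sq ℝ)
    · exact (((h3.comp y contDiffAt_snd).sub contDiffAt_const).norm_sq ℝ)
  refine ⟨fderiv ℝ k y, ⟨k, hkC, rfl, ?_⟩, ?_⟩
  · rw [IsLocalMinOn, nhdsWithin_univ]
    filter_upwards [Metric.isOpen_ball.mem_nhds hyb] with x hx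
    have := hymin (x, s) ⟨Metric.ball_subset_closedBall hx, hsA⟩
    simp only [hg, hP] at this
    simp only [hk]
    linarith
  · rw [hkd.fderiv]
    -- The penalty factors through the second variable, so `inl` annihilates it however large `N`
    -- is. The surviving quadratic term has norm at most `2r ≤ ε / 4`.
    have : (fderiv ℝ h y -
      ((sqDeriv (y.1 - y₀.1)).comp (ContinuousLinearMap.fst ℝ Z X) +
        (sqDeriv (y.2 - y₀.2)).comp (ContinuousLinearMap.snd ℝ Z X)) -
      N • (sqDeriv (G y.2 - s)).comp
        ((fderiv ℝ G y.2).comp (ContinuousLinearMap.snd ℝ Z X))).comp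
          (ContinuousLinearMap.inl ℝ Z X) - (fderiv ℝ h y₀).comp (ContinuousLinearMap.inl ℝ Z X) =
        ((fderiv ℝ h y).comp (ContinuousLinearMap.inl ℝ Z X) -
          (fderiv ℝ h y₀).comp (ContinuousLinearMap.inl ℝ Z X)) - sqDeriv (y.1 - y₀.1) := by
      ext v
      simp
      ring
    rw [this]
    have hn : ‖y.1 - y₀.1‖ ≤ dist y y₀ := by
      rw [← dist_eq_norm]; exact (le_max_left _ _)
    have hr8 : r ≤ ε / 8 := min_le_right _ _
    calc _ ≤ _ := norm_sub_le _ _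
      _ < ε / 2 + ε / 2 := add_lt_add h4 (by linarith [norm_sqDeriv_le (y.1 - y₀.1)])
      _ = ε := add_halves ε

end Unconstrain

/-! ### Decoupling the stages by penalizing the dynamics -/

section Decoupling

theorem sum_eq_sum_add_sub {ι : Type*} [Fintype ι] {a b : ι → ℝ} (i : ι)
    (h : ∀ j, j ≠ i → a j = b j) : ∑ j, a j = ∑ j, b j + (a i - b i) := by
  have := Fintype.sum_eq_single (f := fun j => a j - b j) i fun j hj => sub_eq_zero.2 (h j hj)
  rw [Finset.sum_sub_distrib] at this
  linarith

theorem sum_eq_sum_add_sub₂ {ι : Type*} [Fintype ι] {a b : ι → ℝ} {i k : ι} (hik : i ≠ k)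
    (h : ∀ j, j ≠ i → j ≠ k → a j = b j) :
    ∑ j, a j = ∑ j, b j + (a i - b i) + (a k - b k) := by
  have := Fintype.sum_eq_add (f := fun j => a j - b j) i k hik
    fun j hj => sub_eq_zero.2 (h j hj.1 hj.2)
  rw [Finset.sum_sub_distrib] at this
  linarith

variable {n : ℕ} {Z : Type*} {Y : Fin n → Type*}

/-- The states prescribed by the dynamics at the pairs `(z_i, y_i)`, which need not form a
trajectory. -/
def targetState (F : ∀ i, Z × Y i → Z) (z₀ : Z) (z : Fin (n + 1) → Z) (y : ∀ i, Y i) :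
    Fin (n + 1) → Z :=
  Fin.cons z₀ fun i => F i (z i.castSucc, y i)

theorem targetState_update_last (F : ∀ i, Z × Y i → Z) (z₀ : Z) (z : Fin (n + 1) → Z)
    (y : ∀ i, Y i) (w : Z) :
    targetState F z₀ (Function.update z (Fin.last n) w) y = targetState F z₀ z y := by
  unfold targetState
  congr 1
  ext i
  rw [Function.update_of_ne (Fin.castSucc_lt_last i).ne]

theorem targetState_update_of_ne (F : ∀ i, Z × Y i → Z) (z₀ : Z) (z : Fin (n + 1) → Z)
    (y : ∀ i, Y i) (i : Fin n) (w : Z) (w' : Y i) {j : Fin (n + 1)} (hj : j ≠ i.succ) :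
    targetState F z₀ (Function.update z i.castSucc w) (Function.update y i w') j =
      targetState F z₀ z y j := by
  unfold targetState
  cases j using Fin.cases with
  | zero => simp
  | succ k =>
    have hk : k ≠ i := fun h => hj (h ▸ rfl)
    simp only [Fin.cons_succ]
    rw [Function.update_of_ne hk, Function.update_of_ne (fun h => hk (Fin.castSucc_injective _ h))]

theorem targetState_update_self (F : ∀ i, Z × Y i → Z) (z₀ : Z) (z : Fin (n + 1) → Z)
    (y : ∀ i, Y i) (i : Fin n) (w : Z) (w' : Y i) :
    targetState F z₀ (Function.update z i.castSucc w) (Function.update y i w') i.succ =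
      F i (w, w') := by
  simp [targetState]

variable [NormedAddCommGroup Z] [InnerProductSpace ℝ Z] [FiniteDimensional ℝ Z]
  [∀ i, NormedAddCommGroup (Y i)] [∀ i, InnerProductSpace ℝ (Y i)]
  [∀ i, FiniteDimensional ℝ (Y i)]

/-- The costates are the gradients of the penalty terms in the states. Stationarity under separate
variation of `z_n` and of each pair `(z_i, y_i)` gives the approximate adjoint relations; the errors
come only from the localizing quadratics. -/
theorem exists_approx_costates {F : ∀ i, Z × Y i → Z} {ℓ : Z → ℝ} {L : ∀ i, Z × Y i → ℝ}
    {A : ∀ i, Set (Y i)} (hA : ∀ i, IsCompact (A i)) {zb : Fin (n + 1) → Z} {yb : ∀ i, Y i}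
    (hyb : ∀ i, yb i ∈ A i) (hzb : ∀ i : Fin n, zb i.succ = F i (zb i.castSucc, yb i))
    (hF : ∀ i : Fin n, ContDiffAt ℝ 1 (F i) (zb i.castSucc, yb i))
    (hℓ : ∀ᶠ z in 𝓝 (zb (Fin.last n)), ContinuousAt ℓ z)
    (hL : ∀ i : Fin n, ∀ᶠ x in 𝓝 (zb i.castSucc, yb i), ContinuousAt (L i) x)
    (hmin : ∀ᶠ x : (Fin (n + 1) → Z) × (∀ i, Y i) in 𝓝 (zb, yb), (∀ i, x.2 i ∈ A i) →
      x.1 0 = zb 0 → (∀ i : Fin n, x.1 i.succ = F i (x.1 i.castSucc, x.2 i)) →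
      ℓ (zb (Fin.last n)) + ∑ i : Fin n, L i (zb i.castSucc, yb i) ≤
        ℓ (x.1 (Fin.last n)) + ∑ i : Fin n, L i (x.1 i.castSucc, x.2 i))
    {ε : ℝ} (hε : 0 < ε) :
    ∃ (z : Fin (n + 1) → Z) (y : ∀ i, Y i) (p : Fin (n + 1) → Z →L[ℝ] ℝ),
      dist z zb < ε ∧ dist y yb < ε ∧ (∀ i, y i ∈ A i) ∧
      (∃ α ∈ locSubgrad ℓ univ (z (Fin.last n)), ‖α + p (Fin.last n)‖ < ε) ∧
      ∀ i : Fin n, ∃ ξ ∈ locSubgrad (L i) {x | x.2 ∈ A i} (z i.castSucc, y i),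
        ‖ξ - ((p i.succ).comp (fderiv ℝ (F i) (z i.castSucc, y i)) -
          (p i.castSucc).comp (ContinuousLinearMap.fst ℝ Z (Y i)))‖ < ε := by
  have cz : ∀ j, Continuous fun x : (Fin (n + 1) → Z) × (∀ i, Y i) => x.1 j := fun j => by fun_prop
  have cp : ∀ i : Fin n, Continuous fun x : (Fin (n + 1) → Z) × (∀ i, Y i) =>
    (x.1 i.castSucc, x.2 i) := fun i => by fun_prop
  have e1 : ∀ᶠ x : (Fin (n + 1) → Z) × (∀ i, Y i) in 𝓝 (zb, yb),
      ∀ i, ContDiffAt ℝ 1 (F i) (x.1 i.castSucc, x.2 i) :=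
    eventually_all.2 fun i => (cp i).continuousAt.eventually ((hF i).eventually (by simp))
  have e2 : ∀ᶠ x : (Fin (n + 1) → Z) × (∀ i, Y i) in 𝓝 (zb, yb),
      ∀ i, ContinuousAt (L i) (x.1 i.castSucc, x.2 i) :=
    eventually_all.2 fun i => (cp i).continuousAt.eventually (hL i)
  have e3 : ∀ᶠ x : (Fin (n + 1) → Z) × (∀ i, Y i) in 𝓝 (zb, yb),
      ContinuousAt ℓ (x.1 (Fin.last n)) := (cz _).continuousAt.eventually hℓ
  obtain ⟨r₀, hr₀, hball⟩ := Metric.eventually_nhds_iff.1 (e1.and (e2.and (e3.and hmin)))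
  set r : ℝ := min (r₀ / 2) (ε / 8) with hr
  have hrpos : 0 < r := lt_min (half_pos hr₀) (by positivity)
  have hr8 : r ≤ ε / 8 := min_le_right _ _
  have hin : ∀ x ∈ Metric.closedBall (zb, yb) r, dist x (zb, yb) < r₀ := fun y hy =>
    lt_of_le_of_lt (hy.trans (min_le_left _ _)) (half_lt_self hr₀)
  set g : (Fin (n + 1) → Z) × (∀ i, Y i) → ℝ := fun x =>
    ℓ (x.1 (Fin.last n)) + ∑ i : Fin n, L i (x.1 i.castSucc, x.2 i) +
      (∑ j, ‖x.1 j - zb j‖ ^ 2 + ∑ i, ‖x.2 i - yb i‖ ^ 2) with hg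
  set P : (Fin (n + 1) → Z) × (∀ i, Y i) → ℝ := fun x =>
    ∑ j, ‖x.1 j - targetState F (zb 0) x.1 x.2 j‖ ^ 2 with hP
  set C : Set ((Fin (n + 1) → Z) × (∀ i, Y i)) :=
    Metric.closedBall (zb, yb) r ∩ {x | ∀ i, x.2 i ∈ A i} with hCdef
  have hCc : IsCompact C := by
    refine (isCompact_closedBall _ _).inter_right ?_
    rw [ofPred_forall]
    exact isClosed_iInter fun i => (hA i).isClosed.preimage (by fun_prop)
  obtain ⟨N, ⟨z, y⟩, hxC, hxV, hxmin⟩ :=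
    exists_penalized_minimizer (g := g) (P := P) (x₀ := (zb, yb)) hCc
      (by
        intro x hx
        obtain ⟨-, h2, h3, -⟩ := hball (hin x hx.1)
        refine ContinuousAt.continuousWithinAt ?_
        refine ContinuousAt.add (ContinuousAt.add ?_ ?_) (by fun_prop)
        · exact ContinuousAt.comp (x := x) h3 (cz _).continuousAt
        · exact tendsto_finsetSum _ fun i _ => ContinuousAt.comp (x := x) (h2 i) (cp i).continuousAt)
      (by
        intro x hx
        obtain ⟨h1, -⟩ := hball (hin x hx.1)
        refine ContinuousAt.continuousWithinAt ?_
        refine tendsto_finsetSum _ fun j _ => ((ContinuousAt.sub (cz j).continuousAt ?_).norm).pow 2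
        cases j using Fin.cases with
        | zero => exact continuousAt_const
        | succ i =>
          change ContinuousAt (fun x : (Fin (n + 1) → Z) × (∀ i, Y i) =>
            F i (x.1 i.castSucc, x.2 i)) x
          exact ContinuousAt.comp (x := x) (h1 i).continuousAt (cp i).continuousAt)
      (fun _ _ => by positivity) ⟨Metric.mem_closedBall_self hrpos.le, hyb⟩
      (by
        refine Finset.sum_eq_zero fun j _ => ?_
        cases j using Fin.cases with
        | zero => simp [targetState]
        | succ i => simp [targetState, ← hzb])
      (by
        rintro x ⟨hx, hxA⟩ hPx hgx
        have hj : ∀ j, x.1 j = targetState F (zb 0) x.1 x.2 j := by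
          have := (Finset.sum_eq_zero_iff_of_nonneg fun j _ => by positivity).1 hPx
          intro j
          simpa [sub_eq_zero] using this j (Finset.mem_univ j)
        obtain ⟨-, -, -, h4⟩ := hball (hin x hx)
        have h5 := h4 hxA (hj 0) fun i => hj i.succ
        have h0 : ∑ j, ‖x.1 j - zb j‖ ^ 2 + ∑ i, ‖x.2 i - yb i‖ ^ 2 ≤ 0 := by
          simp only [hg, sub_self, norm_zero, ne_eq, OfNat.ofNat_ne_zero, not_false_eq_true,
            zero_pow, Finset.sum_const_zero, add_zero] at hgx
          linarith
        have p1 : 0 ≤ ∑ j, ‖x.1 j - zb j‖ ^ 2 := by positivity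
        have p2 : 0 ≤ ∑ i, ‖x.2 i - yb i‖ ^ 2 := by positivity
        refine Prod.ext (funext fun j => ?_) (funext fun i => ?_)
        · have := (Finset.sum_eq_zero_iff_of_nonneg fun j _ => by positivity).1
            (show ∑ j, ‖x.1 j - zb j‖ ^ 2 = 0 by linarith) j (Finset.mem_univ j)
          simpa [sub_eq_zero] using this
        · have := (Finset.sum_eq_zero_iff_of_nonneg fun j _ => by positivity).1
            (show ∑ i, ‖x.2 i - yb i‖ ^ 2 = 0 by linarith) i (Finset.mem_univ i)
          simpa [sub_eq_zero] using this)
      (Metric.ball_mem_nhds _ hrpos)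
  have hxr : dist (z, y) (zb, yb) < r := hxV
  have hzr : dist z zb < r := (le_max_left _ _).trans_lt hxr
  have hyr : dist y yb < r := (le_max_right _ _).trans_lt hxr
  obtain ⟨hFd, -⟩ := hball (hin _ hxC.1)
  have hyA : ∀ i, y i ∈ A i := hxC.2
  set T := targetState F (zb 0) z y with hT
  have hznorm : ∀ j, ‖z j - zb j‖ < ε / 8 := fun j => by
    rw [← dist_eq_norm]
    exact (dist_le_pi_dist z zb j).trans_lt (hzr.trans_le hr8)
  have hynorm : ∀ i, ‖y i - yb i‖ < ε / 8 := fun i => by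
    rw [← dist_eq_norm]
    exact (dist_le_pi_dist y yb i).trans_lt (hyr.trans_le hr8)
  -- The multiplier `p_j` is the derivative of `w ↦ N ‖w - T_j‖²` at `z_j`.
  refine ⟨z, y, fun j => N • sqDeriv (z j - T j), by linarith, by linarith, hyA, ?_, ?_⟩
  -- The last state feeds no further stage, so moving it changes only its own defect.
  · set k : Z → ℝ := fun w => -(N * ‖w - T (Fin.last n)‖ ^ 2 + ‖w - zb (Fin.last n)‖ ^ 2) with hk
    have hkC : ContDiffAt ℝ 1 k (z (Fin.last n)) := by
      refine ((contDiffAt_const.mul ?_).add ?_).neg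
      · exact ((contDiffAt_id.sub contDiffAt_const).norm_sq ℝ)
      · exact ((contDiffAt_id.sub contDiffAt_const).norm_sq ℝ)
    have hkd : HasFDerivAt k (-(N • (sqDeriv (z (Fin.last n) - T (Fin.last n))).comp
        (ContinuousLinearMap.id ℝ Z) + (sqDeriv (z (Fin.last n) - zb (Fin.last n))).comp
        (ContinuousLinearMap.id ℝ Z))) (z (Fin.last n)) :=
      (((hasFDerivAt_norm_sub_sq (hasFDerivAt_id _) _).const_mul N).add
        (hasFDerivAt_norm_sub_sq (hasFDerivAt_id _) _)).neg
    refine ⟨fderiv ℝ k (z (Fin.last n)), ⟨k, hkC, rfl, ?_⟩, ?_⟩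
    · rw [IsLocalMinOn, nhdsWithin_univ]
      have hcont : Continuous fun w : Z => (Function.update z (Fin.last n) w, y) :=
        (Continuous.update (f := fun _ : Z => z) continuous_const (Fin.last n)
          continuous_id).prodMk continuous_const
      have hev : ∀ᶠ w in 𝓝 (z (Fin.last n)),
          (Function.update z (Fin.last n) w, y) ∈ Metric.ball (zb, yb) r := by
        refine hcont.continuousAt.eventually (Metric.isOpen_ball.mem_nhds ?_)
        simp only [Function.update_eq_self]
        exact hxV
      filter_upwards [hev] with w hw
      have h1 := hxmin _ ⟨Metric.ball_subset_closedBall hw, hyA⟩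
      simp only [hg, hP, targetState_update_last, Function.update_self] at h1
      have s1 := sum_eq_sum_add_sub
        (a := fun j => ‖Function.update z (Fin.last n) w j - T j‖ ^ 2)
        (b := fun j => ‖z j - T j‖ ^ 2) (Fin.last n)
        (fun j hj => by rw [Function.update_of_ne hj])
      have s2 := sum_eq_sum_add_sub
        (a := fun j => ‖Function.update z (Fin.last n) w j - zb j‖ ^ 2)
        (b := fun j => ‖z j - zb j‖ ^ 2) (Fin.last n)
        (fun j hj => by rw [Function.update_of_ne hj])
      have h2 : ∑ i : Fin n, L i (Function.update z (Fin.last n) w i.castSucc, y i) =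
          ∑ i : Fin n, L i (z i.castSucc, y i) :=
        Finset.sum_congr rfl fun i _ => by
          rw [Function.update_of_ne (Fin.castSucc_lt_last i).ne]
      rw [← hT, s1, s2, h2, Function.update_self] at h1
      simp only [hk]
      linarith
    · rw [hkd.fderiv]
      have : -(N • (sqDeriv (z (Fin.last n) - T (Fin.last n))).comp
          (ContinuousLinearMap.id ℝ Z) + (sqDeriv (z (Fin.last n) - zb (Fin.last n))).comp
          (ContinuousLinearMap.id ℝ Z)) + N • sqDeriv (z (Fin.last n) - T (Fin.last n)) =
          -sqDeriv (z (Fin.last n) - zb (Fin.last n)) := by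
        ext v
        simp
      rw [this, norm_neg]
      linarith [norm_sqDeriv_le (z (Fin.last n) - zb (Fin.last n)), hznorm (Fin.last n)]
  · intro i
    -- Moving `(z_i, y_i)` changes exactly two defects: that at `i` through `z_i`, which yields
    -- `-p_i`, and that at `i + 1` through `F_i`, which yields `p_{i+1} ∘ DF_i` because `F_i` enters
    -- this defect with the opposite sign.
    set k : Z × Y i → ℝ := fun w => -(N * ‖w.1 - T i.castSucc‖ ^ 2 +
      N * ‖F i w - z i.succ‖ ^ 2 + (‖w.1 - zb i.castSucc‖ ^ 2 + ‖w.2 - yb i‖ ^ 2)) with hk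
    have hkC : ContDiffAt ℝ 1 k (z i.castSucc, y i) := by
      refine (((contDiffAt_const.mul ?_).add (contDiffAt_const.mul ?_)).add
        (ContDiffAt.add ?_ ?_)).neg
      · exact ((contDiffAt_fst.sub contDiffAt_const).norm_sq ℝ)
      · exact (((hFd i).sub contDiffAt_const).norm_sq ℝ)
      · exact ((contDiffAt_fst.sub contDiffAt_const).norm_sq ℝ)
      · exact ((contDiffAt_snd.sub contDiffAt_const).norm_sq ℝ)
    have hkd : HasFDerivAt k (-(N • (sqDeriv (z i.castSucc - T i.castSucc)).comp
        (ContinuousLinearMap.fst ℝ Z (Y i)) +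
        N • (sqDeriv (F i (z i.castSucc, y i) - z i.succ)).comp
          (fderiv ℝ (F i) (z i.castSucc, y i)) +
        ((sqDeriv (z i.castSucc - zb i.castSucc)).comp (ContinuousLinearMap.fst ℝ Z (Y i)) +
          (sqDeriv (y i - yb i)).comp (ContinuousLinearMap.snd ℝ Z (Y i)))))
        (z i.castSucc, y i) :=
      ((((hasFDerivAt_norm_sub_sq hasFDerivAt_fst _).const_mul N).add
        ((hasFDerivAt_norm_sub_sq
          ((hFd i).differentiableAt one_ne_zero).hasFDerivAt _).const_mul N)).add
        ((hasFDerivAt_norm_sub_sq hasFDerivAt_fst _).add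
          (hasFDerivAt_norm_sub_sq hasFDerivAt_snd _))).neg
    refine ⟨fderiv ℝ k (z i.castSucc, y i), ⟨k, hkC, rfl, ?_⟩, ?_⟩
    · have hcont : Continuous fun w : Z × Y i =>
          (Function.update z i.castSucc w.1, Function.update y i w.2) :=
        (Continuous.update (f := fun _ : Z × Y i => z) continuous_const i.castSucc
          continuous_fst).prodMk
          (Continuous.update (f := fun _ : Z × Y i => y) continuous_const i continuous_snd)
      have hev : ∀ᶠ w in 𝓝 (z i.castSucc, y i),
          (Function.update z i.castSucc w.1, Function.update y i w.2) ∈ Metric.ball (zb, yb) r := by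
        refine hcont.continuousAt.eventually (Metric.isOpen_ball.mem_nhds ?_)
        simp only [Function.update_eq_self]
        exact hxV
      refine eventually_nhdsWithin_iff.2 ?_
      filter_upwards [hev] with w hw hwA
      have hwA' : ∀ j, Function.update y i w.2 j ∈ A j := by
        intro j
        by_cases hj : j = i
        · subst hj
          rw [Function.update_self]
          exact hwA
        · rw [Function.update_of_ne hj]
          exact hyA j
      have h1 := hxmin _ ⟨Metric.ball_subset_closedBall hw, hwA'⟩
      simp only [hg, hP] at h1
      have hne : i.castSucc ≠ i.succ := (Fin.castSucc_lt_succ).ne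
      set z' := Function.update z i.castSucc w.1 with hz'
      set y' := Function.update y i w.2 with hy'
      have zi : z' i.castSucc = w.1 := Function.update_self ..
      have yi : y' i = w.2 := Function.update_self ..
      have zo : ∀ j, j ≠ i.castSucc → z' j = z j := fun j hj => Function.update_of_ne hj ..
      have yo : ∀ j, j ≠ i → y' j = y j := fun j hj => Function.update_of_ne hj ..
      have To : ∀ j, j ≠ i.succ → targetState F (zb 0) z' y' j = T j := fun j hj =>
        targetState_update_of_ne _ _ _ _ _ _ _ hj
      have Ti : targetState F (zb 0) z' y' i.succ = F i w := targetState_update_self ..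
      have s1 := sum_eq_sum_add_sub₂
        (a := fun j => ‖z' j - targetState F (zb 0) z' y' j‖ ^ 2)
        (b := fun j => ‖z j - T j‖ ^ 2) hne (fun j hj hj' => by rw [zo j hj, To j hj'])
      have s2 := sum_eq_sum_add_sub (a := fun j => ‖z' j - zb j‖ ^ 2)
        (b := fun j => ‖z j - zb j‖ ^ 2) i.castSucc (fun j hj => by rw [zo j hj])
      have s3 := sum_eq_sum_add_sub (a := fun j => ‖y' j - yb j‖ ^ 2)
        (b := fun j => ‖y j - yb j‖ ^ 2) i (fun j hj => by rw [yo j hj])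
      have s4 := sum_eq_sum_add_sub (a := fun j => L j (z' j.castSucc, y' j))
        (b := fun j => L j (z j.castSucc, y j)) i
        (fun j hj => by rw [yo j hj, zo _ fun h => hj (Fin.castSucc_injective _ h)])
      simp only [zi, yi, Ti, To _ hne, zo _ hne.symm] at s1 s2 s3 s4
      rw [s1, s2, s3, s4, zo _ (Fin.castSucc_lt_last i).ne', ← hT, norm_sub_rev (z i.succ) (F i w),
        norm_sub_rev (z i.succ) (T i.succ)] at h1
      have hTi : T i.succ = F i (z i.castSucc, y i) := rfl
      rw [hTi] at h1
      simp only [hk]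
      linarith
    · rw [hkd.fderiv]
      have hTi : T i.succ = F i (z i.castSucc, y i) := rfl
      have : -(N • (sqDeriv (z i.castSucc - T i.castSucc)).comp
          (ContinuousLinearMap.fst ℝ Z (Y i)) +
          N • (sqDeriv (F i (z i.castSucc, y i) - z i.succ)).comp
            (fderiv ℝ (F i) (z i.castSucc, y i)) +
          ((sqDeriv (z i.castSucc - zb i.castSucc)).comp (ContinuousLinearMap.fst ℝ Z (Y i)) +
            (sqDeriv (y i - yb i)).comp (ContinuousLinearMap.snd ℝ Z (Y i)))) -
          ((N • sqDeriv (z i.succ - T i.succ)).comp (fderiv ℝ (F i) (z i.castSucc, y i)) -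
            (N • sqDeriv (z i.castSucc - T i.castSucc)).comp (ContinuousLinearMap.fst ℝ Z (Y i))) =
          -((sqDeriv (z i.castSucc - zb i.castSucc)).comp (ContinuousLinearMap.fst ℝ Z (Y i)) +
            (sqDeriv (y i - yb i)).comp (ContinuousLinearMap.snd ℝ Z (Y i))) := by
        rw [hTi, ← neg_sub (z i.succ) (F i _)]
        ext v
        · simp [sqDeriv]
          ring
        · simp [sqDeriv]
          ring
      rw [this, norm_neg]
      have b1 : ‖(sqDeriv (z i.castSucc - zb i.castSucc)).comp (ContinuousLinearMap.fst ℝ Z (Y i))‖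
          ≤ 2 * ‖z i.castSucc - zb i.castSucc‖ * 1 :=
        (ContinuousLinearMap.opNorm_comp_le _ _).trans
          (mul_le_mul (norm_sqDeriv_le _) (ContinuousLinearMap.norm_fst_le _ _ _)
            (norm_nonneg _) (by positivity))
      have b2 : ‖(sqDeriv (y i - yb i)).comp (ContinuousLinearMap.snd ℝ Z (Y i))‖
          ≤ 2 * ‖y i - yb i‖ * 1 :=
        (ContinuousLinearMap.opNorm_comp_le _ _).trans
          (mul_le_mul (norm_sqDeriv_le _) (ContinuousLinearMap.norm_snd_le _ _ _)
            (norm_nonneg _) (by positivity))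
      refine (norm_add_le _ _).trans_lt ?_
      linarith [hznorm i.castSucc, hynorm i]

end Decoupling

/-! ### Passage to the limit in the costates -/

section Limit

theorem tendsto_clm_comp {ι E₁ E₂ E₃ : Type*} [NormedAddCommGroup E₁] [NormedSpace ℝ E₁]
    [NormedAddCommGroup E₂] [NormedSpace ℝ E₂] [NormedAddCommGroup E₃] [NormedSpace ℝ E₃]
    {l : Filter ι} {f : ι → E₂ →L[ℝ] E₃} {g : ι → E₁ →L[ℝ] E₂} {a : E₂ →L[ℝ] E₃} {b : E₁ →L[ℝ] E₂}
    (hf : Tendsto f l (𝓝 a)) (hg : Tendsto g l (𝓝 b)) :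
    Tendsto (fun x => (f x).comp (g x)) l (𝓝 (a.comp b)) :=
  ((continuous_fst.clm_comp continuous_snd).tendsto (a, b)).comp (hf.prodMk_nhds hg)

theorem tendsto_clm_apply {ι E₁ E₂ : Type*} [NormedAddCommGroup E₁] [NormedSpace ℝ E₁]
    [NormedAddCommGroup E₂] [NormedSpace ℝ E₂]
    {l : Filter ι} {f : ι → E₁ →L[ℝ] E₂} {g : ι → E₁} {a : E₁ →L[ℝ] E₂} {b : E₁}
    (hf : Tendsto f l (𝓝 a)) (hg : Tendsto g l (𝓝 b)) :
    Tendsto (fun x => f x (g x)) l (𝓝 (a b)) :=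
  ((continuous_fst.clm_apply continuous_snd).tendsto (a, b)).comp (hf.prodMk_nhds hg)

theorem eventually_continuousAt_of_lipschitzOnWith {Y : Type*} [PseudoMetricSpace Y] {g : Y → ℝ}
    {y : Y} (h : ∃ K : NNReal, ∃ s ∈ 𝓝 y, LipschitzOnWith K g s) :
    ∀ᶠ x in 𝓝 y, ContinuousAt g x := by
  obtain ⟨K, s, hs, hg⟩ := h
  filter_upwards [eventually_mem_nhds_iff.2 hs] with x hx
  exact hg.continuousOn.continuousAt hx

variable {n : ℕ} {Z : Type*} {Y : Fin n → Type*}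
  [NormedAddCommGroup Z] [InnerProductSpace ℝ Z] [FiniteDimensional ℝ Z]
  [∀ i, NormedAddCommGroup (Y i)] [∀ i, InnerProductSpace ℝ (Y i)]
  [∀ i, FiniteDimensional ℝ (Y i)]

/-- The maximum principle in coordinates, with `∂_L` replaced by approximation by local
subgradients. -/
theorem exists_costates {F : ∀ i, Z × Y i → Z} {ℓ : Z → ℝ} {L : ∀ i, Z × Y i → ℝ}
    {A : ∀ i, Set (Y i)} (hA : ∀ i, IsCompact (A i)) {zb : Fin (n + 1) → Z} {yb : ∀ i, Y i}
    (hyb : ∀ i, yb i ∈ A i) (hzb : ∀ i : Fin n, zb i.succ = F i (zb i.castSucc, yb i))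
    (hF : ∀ i : Fin n, ContDiffAt ℝ 1 (F i) (zb i.castSucc, yb i))
    (hℓ : ∃ K : NNReal, ∃ s ∈ 𝓝 (zb (Fin.last n)), LipschitzOnWith K ℓ s)
    (hL : ∀ i : Fin n, ∃ K : NNReal, ∃ s ∈ 𝓝 (zb i.castSucc, yb i), LipschitzOnWith K (L i) s)
    (hLA : ∀ i : Fin n, ∀ w ∈ A i, ContinuousAt (L i) (zb i.castSucc, w))
    (hconv : ∀ i : Fin n, ∀ᶠ z in 𝓝 (zb i.castSucc), ConvexOn ℝ (A i) fun y => L i (z, y))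
    (hmin : ∀ᶠ x : (Fin (n + 1) → Z) × (∀ i, Y i) in 𝓝 (zb, yb), (∀ i, x.2 i ∈ A i) →
      x.1 0 = zb 0 → (∀ i : Fin n, x.1 i.succ = F i (x.1 i.castSucc, x.2 i)) →
      ℓ (zb (Fin.last n)) + ∑ i : Fin n, L i (zb i.castSucc, yb i) ≤
        ℓ (x.1 (Fin.last n)) + ∑ i : Fin n, L i (x.1 i.castSucc, x.2 i)) :
    ∃ p a : Fin (n + 1) → Z →L[ℝ] ℝ, p (Fin.last n) = -a (Fin.last n) ∧
      (∀ i : Fin n, p i.castSucc = -a i.castSucc + (p i.succ).comp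
        ((fderiv ℝ (F i) (zb i.castSucc, yb i)).comp (ContinuousLinearMap.inl ℝ Z (Y i)))) ∧
      (∀ ε > 0, ∃ z, dist z (zb (Fin.last n)) < ε ∧
        ∃ α ∈ locSubgrad ℓ univ z, ‖α - a (Fin.last n)‖ < ε) ∧
      (∀ i : Fin n, ∀ ε > 0, ∃ x : Z × Y i, dist x (zb i.castSucc, yb i) < ε ∧ x.2 ∈ A i ∧
        ∃ ξ ∈ locSubgrad (L i) {x | x.2 ∈ A i} x,
          ‖ξ.comp (ContinuousLinearMap.inl ℝ Z (Y i)) - a i.castSucc‖ < ε) ∧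
      ∀ i : Fin n, ∀ w ∈ A i, p i.succ (fderiv ℝ (F i) (zb i.castSucc, yb i) (0, w - yb i)) ≤
        L i (zb i.castSucc, w) - L i (zb i.castSucc, yb i) := by
  have key := fun N : ℕ =>
    exists_approx_costates hA hyb hzb hF (eventually_continuousAt_of_lipschitzOnWith hℓ)
      (fun i => eventually_continuousAt_of_lipschitzOnWith (hL i)) hmin
      (Nat.one_div_pos_of_nat (α := ℝ) (n := N))
  choose z y p hz hy hyA hlast ξ hξ hξp using key
  choose α hα hαp using hlast
  have hε0 : Tendsto (fun N : ℕ => 1 / ((N : ℝ) + 1)) atTop (𝓝 0) :=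
    tendsto_one_div_add_atTop_nhds_zero_nat
  have tz : Tendsto z atTop (𝓝 zb) :=
    tendsto_iff_dist_tendsto_zero.2 (squeeze_zero (fun _ => dist_nonneg) (fun N => (hz N).le) hε0)
  have ty : Tendsto y atTop (𝓝 yb) :=
    tendsto_iff_dist_tendsto_zero.2 (squeeze_zero (fun _ => dist_nonneg) (fun N => (hy N).le) hε0)
  have tzj : ∀ j, Tendsto (fun N => z N j) atTop (𝓝 (zb j)) := fun j => tendsto_pi_nhds.1 tz j
  have tyj : ∀ i, Tendsto (fun N => y N i) atTop (𝓝 (yb i)) := fun j => tendsto_pi_nhds.1 ty j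
  have txi : ∀ i : Fin n, Tendsto (fun N => (z N i.castSucc, y N i)) atTop
    (𝓝 (zb i.castSucc, yb i)) := fun i => (tzj _).prodMk_nhds (tyj i)
  have tF : ∀ i : Fin n, Tendsto (fun N => fderiv ℝ (F i) (z N i.castSucc, y N i)) atTop
      (𝓝 (fderiv ℝ (F i) (zb i.castSucc, yb i))) := fun i =>
    ((hF i).continuousAt_fderiv one_ne_zero).tendsto.comp (txi i)
  have hle1 : ∀ N : ℕ, 1 / ((N : ℝ) + 1) ≤ 1 := fun N => by
    rw [div_le_one (by positivity)]
    linarith [N.cast_nonneg (α := ℝ)]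
  have tα : Tendsto (fun N => α N + p N (Fin.last n)) atTop (𝓝 0) :=
    squeeze_zero_norm (fun N => (hαp N).le) hε0
  have tξ : ∀ i : Fin n, Tendsto (fun N => ξ N i - ((p N i.succ).comp
      (fderiv ℝ (F i) (z N i.castSucc, y N i)) -
        (p N i.castSucc).comp (ContinuousLinearMap.fst ℝ Z (Y i)))) atTop (𝓝 0) := fun i =>
    squeeze_zero_norm (fun N => (hξp N i).le) hε0
  have hinl : ∀ i (v : Z), ‖ContinuousLinearMap.inl ℝ Z (Y i) v‖ ≤ ‖v‖ := fun i v => by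
    simp [Prod.norm_def]
  have hinl1 : ∀ i, ‖ContinuousLinearMap.inl ℝ Z (Y i)‖ ≤ 1 := fun i =>
    ContinuousLinearMap.opNorm_le_bound _ zero_le_one fun v => by simp [Prod.norm_def]
  -- Backward induction: `p_n` is controlled by the Lipschitz constant of `ℓ`, and `p_i` by that of
  -- `L_i` together with the bound on `p_{i+1}`. Only state directions are used, and these the
  -- control constraint leaves free.
  have hbdd : ∀ j, ∃ M, ∀ᶠ N in atTop, ‖p N j‖ ≤ M := by
    intro j
    induction j using Fin.reverseInduction with
    | last =>
      obtain ⟨K, s, hs, hK⟩ := hℓ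
      refine ⟨K + 1, ?_⟩
      filter_upwards [(tzj (Fin.last n)).eventually (eventually_mem_nhds_iff.2 hs)] with N hN
      have h1 := locSubgrad_norm_comp_le (hα N) (ContinuousLinearMap.id ℝ Z) (by simp)
        (by simp) hN hK
      rw [ContinuousLinearMap.comp_id] at h1
      have h2 : p N (Fin.last n) = (α N + p N (Fin.last n)) - α N := by abel
      rw [h2]
      refine (norm_sub_le _ _).trans ?_
      linarith [hαp N, hle1 N]
    | cast i ih =>
      obtain ⟨M, hM⟩ := ih
      obtain ⟨K, s, hs, hK⟩ := hL i
      obtain ⟨D, hD⟩ : ∃ D, ‖fderiv ℝ (F i) (zb i.castSucc, yb i)‖ < D := exists_gt _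
      refine ⟨K + (1 + M * D), ?_⟩
      have hDev : ∀ᶠ N in atTop, ‖fderiv ℝ (F i) (z N i.castSucc, y N i)‖ ≤ D := by
        have h := ((continuous_norm (E := Z × Y i →L[ℝ] Z)).tendsto _).comp (tF i)
        exact h.eventually (eventually_le_nhds hD)
      filter_upwards [(txi i).eventually (eventually_mem_nhds_iff.2 hs), hM, hDev]
        with N hN hMN hDN
      have h1 := locSubgrad_norm_comp_le (hξ N i) (ContinuousLinearMap.inl ℝ Z (Y i)) (hinl i)
        (fun v t => by
          change y N i + t • (0 : Y i) ∈ A i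
          rw [smul_zero, add_zero]
          exact hyA N i) hN hK
      set R := ξ N i - ((p N i.succ).comp (fderiv ℝ (F i) (z N i.castSucc, y N i)) -
        (p N i.castSucc).comp (ContinuousLinearMap.fst ℝ Z (Y i))) with hR
      have h2 : p N i.castSucc = (R.comp (ContinuousLinearMap.inl ℝ Z (Y i)) +
          ((p N i.succ).comp (fderiv ℝ (F i) (z N i.castSucc, y N i))).comp
            (ContinuousLinearMap.inl ℝ Z (Y i))) -
          (ξ N i).comp (ContinuousLinearMap.inl ℝ Z (Y i)) := by
        ext v
        simp only [hR, add_apply, sub_apply, ContinuousLinearMap.comp_apply,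
          ContinuousLinearMap.coe_fst', ContinuousLinearMap.inl_apply]
        ring
      have h3 : ‖R.comp (ContinuousLinearMap.inl ℝ Z (Y i))‖ ≤ 1 :=
        (ContinuousLinearMap.opNorm_comp_le _ _).trans
          (mul_le_one₀ ((hξp N i).le.trans (hle1 N)) (norm_nonneg _) (hinl1 i))
      have h4 : ‖((p N i.succ).comp (fderiv ℝ (F i) (z N i.castSucc, y N i))).comp
            (ContinuousLinearMap.inl ℝ Z (Y i))‖ ≤ M * D := by
        refine (ContinuousLinearMap.opNorm_comp_le _ _).trans ?_
        refine (mul_le_of_le_one_right (norm_nonneg _) (hinl1 i)).trans ?_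
        refine (ContinuousLinearMap.opNorm_comp_le _ _).trans ?_
        exact mul_le_mul hMN hDN (norm_nonneg _) ((norm_nonneg _).trans hMN)
      rw [h2]
      refine (norm_sub_le _ _).trans ?_
      have := norm_add_le (R.comp (ContinuousLinearMap.inl ℝ Z (Y i)))
        (((p N i.succ).comp (fderiv ℝ (F i) (z N i.castSucc, y N i))).comp
            (ContinuousLinearMap.inl ℝ Z (Y i)))
      linarith
  choose M hM using hbdd
  have hev : ∀ᶠ N in atTop, p N ∈ Set.pi univ fun j => Metric.closedBall (0 : Z →L[ℝ] ℝ) (M j) := by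
    filter_upwards [eventually_all.2 hM] with N hN j _
    simpa using hN j
  obtain ⟨pb, -, φ, hφ, hpφ⟩ := (isCompact_univ_pi fun j =>
    isCompact_closedBall (0 : Z →L[ℝ] ℝ) (M j)).tendsto_subseq' hev.frequently
  have hφt := hφ.tendsto_atTop
  have tp : ∀ j, Tendsto (fun N => p (φ N) j) atTop (𝓝 (pb j)) := fun j => tendsto_pi_nhds.1 hpφ j
  have tξφ : ∀ i : Fin n, Tendsto (fun N => ξ (φ N) i) atTop
      (𝓝 ((pb i.succ).comp (fderiv ℝ (F i) (zb i.castSucc, yb i)) -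
        (pb i.castSucc).comp (ContinuousLinearMap.fst ℝ Z (Y i)))) := by
    intro i
    have h1 := (tendsto_clm_comp (tp i.succ) ((tF i).comp hφt)).sub
      (tendsto_clm_comp (tp i.castSucc) (tendsto_const_nhds (x := ContinuousLinearMap.fst ℝ Z (Y i))))
    have h2 := ((tξ i).comp hφt).add h1
    rw [zero_add] at h2
    refine h2.congr fun N => ?_
    simp only [Function.comp_apply]
    abel
  -- Read off from the adjoint recursion, which then holds identically; it remains to see that these
  -- covectors are limits of subgradients.
  let a : Fin (n + 1) → Z →L[ℝ] ℝ := Fin.lastCases (-pb (Fin.last n)) fun i =>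
    (pb i.succ).comp ((fderiv ℝ (F i) (zb i.castSucc, yb i)).comp
      (ContinuousLinearMap.inl ℝ Z (Y i))) - pb i.castSucc
  have alast : a (Fin.last n) = -pb (Fin.last n) := Fin.lastCases_last
  have acast : ∀ i : Fin n, a i.castSucc = (pb i.succ).comp
      ((fderiv ℝ (F i) (zb i.castSucc, yb i)).comp
      (ContinuousLinearMap.inl ℝ Z (Y i))) - pb i.castSucc := fun i => Fin.lastCases_castSucc ..
  refine ⟨pb, a, by rw [alast, neg_neg], fun i => by rw [acast]; abel, ?_, ?_, ?_⟩
  · intro ε hε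
    have h1 : Tendsto (fun N => α (φ N)) atTop (𝓝 (a (Fin.last n))) := by
      have := (tα.comp hφt).sub (tp (Fin.last n))
      rw [zero_sub, ← alast] at this
      refine this.congr fun N => ?_
      simp
    have e1 := Metric.tendsto_nhds.1 h1 ε hε
    have e2 := Metric.tendsto_nhds.1 ((tzj (Fin.last n)).comp hφt) ε hε
    obtain ⟨N, h1, h2⟩ := (e1.and e2).exists
    exact ⟨z (φ N) (Fin.last n), h2, α (φ N), hα _, by rwa [← dist_eq_norm]⟩
  · intro i ε hε
    have h1 : Tendsto (fun N => (ξ (φ N) i).comp (ContinuousLinearMap.inl ℝ Z (Y i))) atTop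
        (𝓝 (a i.castSucc)) := by
      have := tendsto_clm_comp (tξφ i) (tendsto_const_nhds (x := ContinuousLinearMap.inl ℝ Z (Y i)))
      convert this using 2
      rw [acast]
      ext v
      simp
    have e1 := Metric.tendsto_nhds.1 h1 ε hε
    have e2 := Metric.tendsto_nhds.1 ((txi i).comp hφt) ε hε
    obtain ⟨N, h1, h2⟩ := (e1.and e2).exists
    exact ⟨_, h2, hyA _ i, ξ (φ N) i, hξ _ i, by rwa [← dist_eq_norm]⟩
  -- In a direction `(0, v)` the term with `p_i` vanishes and only `p_{i+1} ∘ DF_i` remains.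
  · intro i w hw
    have h1 : Tendsto (fun N => ξ (φ N) i (0, w - y (φ N) i)) atTop
        (𝓝 (pb i.succ (fderiv ℝ (F i) (zb i.castSucc, yb i) (0, w - yb i)))) := by
      have := tendsto_clm_apply (tξφ i) ((tendsto_const_nhds (x := (0 : Z))).prodMk_nhds
        ((tendsto_const_nhds (x := w)).sub ((tyj i).comp hφt)))
      rwa [sub_apply, ContinuousLinearMap.comp_apply,
        ContinuousLinearMap.comp_apply, ContinuousLinearMap.coe_fst', map_zero, sub_zero] at this
    have h2 : Tendsto (fun N => L i (z (φ N) i.castSucc, w) - L i (z (φ N) i.castSucc, y (φ N) i))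
        atTop (𝓝 (L i (zb i.castSucc, w) - L i (zb i.castSucc, yb i))) := by
      refine Tendsto.sub ?_ ?_
      · exact (hLA i w hw).tendsto.comp (((tzj _).comp hφt).prodMk_nhds tendsto_const_nhds)
      · exact (hLA i _ (hyb i)).tendsto.comp ((txi i).comp hφt)
    refine le_of_tendsto_of_tendsto h1 h2 ?_
    filter_upwards [((tzj i.castSucc).comp hφt).eventually (hconv i)] with N hN
    exact locSubgrad_le_of_convexOn hN (hyA _ i) hw (hξ _ i)

/-- If the first components of unconstrained subgradients of a locally Lipschitz function accumulate
at `a`, then the subgradients accumulate at some covector with first component `a`. -/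
theorem exists_limit_of_locSubgrad_fst {X : Type*} [NormedAddCommGroup X] [InnerProductSpace ℝ X]
    [FiniteDimensional ℝ X] {L : Z × X → ℝ} {x₀ : Z × X}
    (hL : ∃ K : NNReal, ∃ s ∈ 𝓝 x₀, LipschitzOnWith K L s) {a : Z →L[ℝ] ℝ}
    (h : ∀ ε > 0, ∃ x, dist x x₀ < ε ∧ ∃ η ∈ locSubgrad L univ x,
      ‖η.comp (ContinuousLinearMap.inl ℝ Z X) - a‖ < ε) :
    ∃ b : X →L[ℝ] ℝ, ∀ ε > 0, ∃ x, dist x x₀ < ε ∧ ∃ η ∈ locSubgrad L univ x,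
      ‖η - (a.comp (ContinuousLinearMap.fst ℝ Z X) + b.comp (ContinuousLinearMap.snd ℝ Z X))‖
        < ε := by
  obtain ⟨K, s, hs, hK⟩ := hL
  choose x hx η hη hηa using fun N : ℕ => h _ (Nat.one_div_pos_of_nat (α := ℝ) (n := N))
  have hε0 : Tendsto (fun N : ℕ => 1 / ((N : ℝ) + 1)) atTop (𝓝 0) :=
    tendsto_one_div_add_atTop_nhds_zero_nat
  have tx : Tendsto x atTop (𝓝 x₀) :=
    tendsto_iff_dist_tendsto_zero.2 (squeeze_zero (fun _ => dist_nonneg) (fun N => (hx N).le) hε0)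
  have tηa : Tendsto (fun N => (η N).comp (ContinuousLinearMap.inl ℝ Z X)) atTop (𝓝 a) :=
    tendsto_iff_norm_sub_tendsto_zero.2
      (squeeze_zero (fun _ => norm_nonneg _) (fun N => (hηa N).le) hε0)
  have hev : ∀ᶠ N in atTop, η N ∈ Metric.closedBall (0 : Z × X →L[ℝ] ℝ) K := by
    filter_upwards [tx.eventually (eventually_mem_nhds_iff.2 hs)] with N hN
    have h1 := locSubgrad_norm_comp_le (hη N) (ContinuousLinearMap.id ℝ (Z × X)) (by simp)
      (by simp) hN hK
    simpa using h1
  have : ProperSpace (Z × X →L[ℝ] ℝ) := FiniteDimensional.proper ℝ (Z × X →L[ℝ] ℝ)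
  obtain ⟨ηb, -, φ, hφ, hηφ⟩ :=
    (isCompact_closedBall (0 : Z × X →L[ℝ] ℝ) K).tendsto_subseq' hev.frequently
  have ha : ηb.comp (ContinuousLinearMap.inl ℝ Z X) = a :=
    tendsto_nhds_unique (tendsto_clm_comp hηφ tendsto_const_nhds) (tηa.comp hφ.tendsto_atTop)
  refine ⟨ηb.comp (ContinuousLinearMap.inr ℝ Z X), fun ε hε => ?_⟩
  have hηb : a.comp (ContinuousLinearMap.fst ℝ Z X) +
      (ηb.comp (ContinuousLinearMap.inr ℝ Z X)).comp (ContinuousLinearMap.snd ℝ Z X) = ηb := by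
    rw [← ha]
    ext v <;> simp [Prod.mk_zero_zero]
  rw [hηb]
  obtain ⟨N, h1, h2⟩ := ((Metric.tendsto_nhds.1 hηφ ε hε).and
    (Metric.tendsto_nhds.1 (tx.comp hφ.tendsto_atTop) ε hε)).exists
  exact ⟨_, h2, _, hη _, by rwa [← dist_eq_norm]⟩

/-- Limits of subgradients of a locally Lipschitz function exist. -/
theorem exists_limit_of_locSubgrad {X : Type*} [NormedAddCommGroup X] [InnerProductSpace ℝ X]
    [FiniteDimensional ℝ X] {g : X → ℝ} {x₀ : X}
    (hg : ∃ K : NNReal, ∃ s ∈ 𝓝 x₀, LipschitzOnWith K g s) :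
    ∃ b : X →L[ℝ] ℝ, ∀ ε > 0, ∃ x, dist x x₀ < ε ∧ ∃ η ∈ locSubgrad g univ x, ‖η - b‖ < ε := by
  -- With no stages the only feasible state is `x₀`, so minimality holds for every `g`, and the
  -- penalized problem produces subgradients near `x₀`.
  obtain ⟨p, a, -, -, h, -⟩ := exists_costates (n := 0) (Z := X) (Y := fun _ => X)
    (F := fun i => i.elim0) (ℓ := g) (L := fun i => i.elim0) (A := fun i => i.elim0)
    (zb := fun _ => x₀) (yb := fun i => i.elim0) (fun i => i.elim0) (fun i => i.elim0)
    (fun i => i.elim0) (fun i => i.elim0) hg (fun i => i.elim0) (fun i => i.elim0)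
    (fun i => i.elim0)
    (Eventually.of_forall fun x _ h0 _ => by
      have : x.1 (Fin.last 0) = x₀ := h0
      rw [this]
      simp)
  exact ⟨_, h⟩

end Limit

/-! ### Change of variables and ambient control coordinates -/

section LocalSubgradientCalculus

variable {Y Z : Type*} [NormedAddCommGroup Y] [NormedSpace ℝ Y]
  [NormedAddCommGroup Z] [NormedSpace ℝ Z]

theorem lipschitzOnWith_comp_of_contDiffAt {g : Z → ℝ} {T : Y → Z} {y : Y}
    (hg : ∃ K : NNReal, ∃ s ∈ 𝓝 (T y), LipschitzOnWith K g s) (hT : ContDiffAt ℝ 1 T y) :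
    ∃ K : NNReal, ∃ s ∈ 𝓝 y, LipschitzOnWith K (g ∘ T) s := by
  obtain ⟨K, s, hs, hK⟩ := hg
  obtain ⟨K', t, ht, hK'⟩ := hT.exists_lipschitzOnWith
  exact ⟨K * K', t ∩ T ⁻¹' s, inter_mem ht (hT.continuousAt hs),
    hK.comp (hK'.mono inter_subset_left) fun x hx => hx.2⟩

theorem locSubgrad_comp {g : Z → ℝ} {g' : Y → ℝ} {T : Y → Z} {S : Set Z} {y : Y}
    {ξ : Z →L[ℝ] ℝ} (hξ : ξ ∈ locSubgrad g S (T y)) (hT : ContDiffAt ℝ 1 T y)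
    (hg : ∀ᶠ x in 𝓝 y, g' x = g (T x)) :
    ξ.comp (fderiv ℝ T y) ∈ locSubgrad g' (T ⁻¹' S) y := by
  obtain ⟨h, hC, rfl, hmin⟩ := hξ
  refine ⟨h ∘ T, hC.comp y hT, ?_, ?_⟩
  · exact fderiv_comp y (hC.differentiableAt one_ne_zero) (hT.differentiableAt one_ne_zero)
  · refine eventually_nhdsWithin_iff.2 ?_
    filter_upwards [hT.continuousAt.eventually (eventually_nhdsWithin_iff.1 hmin), hg]
      with x hx hgx hxS
    rw [hgx, hg.self_of_nhds]
    exact hx hxS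

end LocalSubgradientCalculus

section AmbientCoordinates

variable {Z X W : Type*} [NormedAddCommGroup Z] [InnerProductSpace ℝ Z] [FiniteDimensional ℝ Z]
  [NormedAddCommGroup X] [InnerProductSpace ℝ X] [FiniteDimensional ℝ X]
  [NormedAddCommGroup W] [InnerProductSpace ℝ W]

/-- Let `G` parametrize a submanifold of `W` with local left inverse `σ`. Subgradients, relative to
a subset `A` of the submanifold, of the extension of `L` by `σ` yield unconstrained subgradients
of `L` with almost the same first component. -/
theorem exists_locSubgrad_of_ambient {L : Z × X → ℝ} {G : X → W} {σ : W → X} {A : Set W}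
    (hA : IsCompact A) {z₀ : Z} {x₀ : X} (hG : ContDiffAt ℝ 1 G x₀) (hσ : ContinuousAt σ (G x₀))
    (hσG : ∀ᶠ x in 𝓝 x₀, σ (G x) = x) (hGσ : ∀ w ∈ A, G (σ w) = w)
    (hL : ∃ K : NNReal, ∃ s ∈ 𝓝 (z₀, x₀), LipschitzOnWith K L s) {a : Z →L[ℝ] ℝ}
    (h : ∀ ε > 0, ∃ x : Z × W, dist x (z₀, G x₀) < ε ∧ x.2 ∈ A ∧
      ∃ ξ ∈ locSubgrad (fun y : Z × W => L (y.1, σ y.2)) {x | x.2 ∈ A} x,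
        ‖ξ.comp (ContinuousLinearMap.inl ℝ Z W) - a‖ < ε) {ε : ℝ} (hε : 0 < ε) :
    ∃ x, dist x (z₀, x₀) < ε ∧ ∃ η ∈ locSubgrad L univ x,
      ‖η.comp (ContinuousLinearMap.inl ℝ Z X) - a‖ < ε := by
  have hσx : σ (G x₀) = x₀ := hσG.self_of_nhds
  have hcont : ContinuousAt (fun y : Z × W => (y.1, σ y.2)) (z₀, G x₀) :=
    continuousAt_fst.prodMk (ContinuousAt.comp (f := Prod.snd) (x := (z₀, G x₀)) hσ continuousAt_snd)
  have hev : ∀ᶠ x : Z × X in 𝓝 (z₀, x₀), ContDiffAt ℝ 1 G x.2 ∧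
      (∀ᶠ x' : Z × X in 𝓝 x, σ (G x'.2) = x'.2) ∧ (∀ᶠ x' in 𝓝 x, ContinuousAt L x') ∧
      dist x (z₀, x₀) < ε / 2 := by
    have h1 : ∀ᶠ x : Z × X in 𝓝 (z₀, x₀), ContDiffAt ℝ 1 G x.2 :=
      continuousAt_snd.eventually (hG.eventually (by simp))
    have h2 : ∀ᶠ x : Z × X in 𝓝 (z₀, x₀), σ (G x.2) = x.2 := 
      Tendsto.eventually (p := fun x => σ (G x) = x) (continuous_snd.tendsto (z₀, x₀)) hσG
    have h3 := eventually_continuousAt_of_lipschitzOnWith hL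
    have h4 : ∀ᶠ x : Z × X in 𝓝 (z₀, x₀), dist x (z₀, x₀) < ε / 2 :=
      Metric.ball_mem_nhds _ (half_pos hε)
    exact h1.and (h2.eventually_nhds.and (h3.eventually_nhds.and h4))
  have hev' := hcont.eventually (p := fun x => ContDiffAt ℝ 1 G x.2 ∧
      (∀ᶠ x' : Z × X in 𝓝 x, σ (G x'.2) = x'.2) ∧ (∀ᶠ x' in 𝓝 x, ContinuousAt L x') ∧
      dist x (z₀, x₀) < ε / 2) (by simpa only [hσx] using hev)
  obtain ⟨δ, hδ, hball⟩ := Metric.eventually_nhds_iff.1 hev'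
  obtain ⟨⟨z, w⟩, hx, hwA, ξ, hξ, hξa⟩ := h (min δ (ε / 2)) (lt_min hδ (half_pos hε))
  obtain ⟨hGx, hσGx, hLx, hxd⟩ := hball (hx.trans_le (min_le_left _ _))
  have hwA : w ∈ A := hwA
  have hGw : G (σ w) = w := hGσ w hwA
  -- Since `σ ∘ G = id` near the point, pulling back along `T` recovers `L` from its extension and
  -- turns `w ∈ A` into `G x ∈ A`. As `T` is the identity on states, the first component is
  -- unchanged.
  set T : Z × X → Z × W := fun x => (x.1, G x.2) with hTdef
  have hTx : T (z, σ w) = (z, w) := by simp [hTdef, hGw]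
  have hTd : HasFDerivAt T ((ContinuousLinearMap.fst ℝ Z X).prod
      ((fderiv ℝ G (σ w)).comp (ContinuousLinearMap.snd ℝ Z X))) (z, σ w) :=
    hasFDerivAt_fst.prodMk
      ((hGx.differentiableAt one_ne_zero).hasFDerivAt.comp (z, σ w) hasFDerivAt_snd)
  have hTC : ContDiffAt ℝ 1 T (z, σ w) :=
    contDiffAt_fst.prodMk (ContDiffAt.comp (z, σ w) hGx contDiffAt_snd)
  have hη := locSubgrad_comp (g' := L) (y := (z, σ w)) (T := T) (hTx.symm ▸ hξ) hTC (by
    filter_upwards [hσGx] with x' hx'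
    simp [hTdef, hx'])
  obtain ⟨y, hy, η, hηm, hηd⟩ := exists_locSubgrad_univ_near (G := G) hA (y₀ := (z, σ w)) hGx
    (by simpa [hGw] using hwA) hLx (ξ := ξ.comp (fderiv ℝ T (z, σ w))) hη (half_pos hε)
  refine ⟨y, ?_, η, hηm, ?_⟩
  · calc dist y (z₀, x₀) ≤ dist y (z, σ w) + dist (z, σ w) (z₀, x₀) := dist_triangle _ _ _
      _ < ε / 2 + ε / 2 := add_lt_add hy hxd
      _ = ε := add_halves ε
  · have hcomp : (ξ.comp (fderiv ℝ T (z, σ w))).comp (ContinuousLinearMap.inl ℝ Z X) =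
        ξ.comp (ContinuousLinearMap.inl ℝ Z W) := by
      rw [hTd.fderiv]
      ext v
      simp
    rw [hcomp] at hηd
    calc _ = ‖(η.comp (ContinuousLinearMap.inl ℝ Z X) - ξ.comp (ContinuousLinearMap.inl ℝ Z W)) +
          (ξ.comp (ContinuousLinearMap.inl ℝ Z W) - a)‖ := by rw [sub_add_sub_cancel]
      _ ≤ _ := norm_add_le _ _
      _ < ε / 2 + ε / 2 := add_lt_add hηd (hξa.trans_le (min_le_right _ _))
      _ = ε := add_halves ε

end AmbientCoordinates

/-! ### Transfer between charts and manifolds -/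

section Manifold

variable {E : Type*} [NormedAddCommGroup E] [NormedSpace ℝ E]
  {H : Type*} [TopologicalSpace H] {I : ModelWithCorners ℝ E H}
  {M : Type*} [TopologicalSpace M] [ChartedSpace H M] [IsManifold I ∞ M]

theorem contMDiffAt_extChartAt_symm_of_mem_target [I.Boundaryless] (x : M) {e : E}
    (he : e ∈ (extChartAt I x).target) : ContMDiffAt 𝓘(ℝ, E) I ∞ (extChartAt I x).symm e :=
  (contMDiffOn_extChartAt_symm x).contMDiffAt ((isOpen_extChartAt_target x).mem_nhds he)

/-- A `C^1` function near a point is the germ of a global `C^1` function. -/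
theorem exists_contMDiff_eventuallyEq [FiniteDimensional ℝ E] [T2Space M] {g : M → ℝ} {y : M}
    (hg : ∀ᶠ x in 𝓝 y, ContMDiffAt I 𝓘(ℝ, ℝ) 1 g x) :
    ∃ g' : M → ℝ, ContMDiff I 𝓘(ℝ, ℝ) 1 g' ∧ g' =ᶠ[𝓝 y] g := by
  obtain ⟨f, -, hf⟩ := (SmoothBumpFunction.nhds_basis_tsupport (I := I) y).mem_iff.1 hg
  refine ⟨fun x => f x • g x, contMDiff_of_tsupport fun x hx => ?_, ?_⟩
  · have hx' : x ∈ tsupport f := tsupport_smul_subset_left _ _ hx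
    exact (f.contMDiffAt.of_le (by simp)).smul (hf hx')
  · filter_upwards [f.eventuallyEq_one] with x hx
    simp [hx]

/-- The test function is `C^1` only near a point of the chart, whereas `frechetSubdiff` asks for a
global one; a smooth cutoff extends its germ. -/
theorem frechetSubdiff_of_locSubgrad [I.Boundaryless] [FiniteDimensional ℝ E] [T2Space M] {f : M → ℝ} {x y : M}
    (hy : y ∈ (extChartAt I x).source) {ξ : E →L[ℝ] ℝ}
    (hξ : ξ ∈ locSubgrad (f ∘ (extChartAt I x).symm) univ (extChartAt I x y)) :
    (ξ.comp (mfderiv I 𝓘(ℝ, E) (extChartAt I x) y) : Cotangent I y) ∈ frechetSubdiff I f y := by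
  obtain ⟨h, hC, rfl, hmin⟩ := hξ
  rw [IsLocalMinOn, nhdsWithin_univ] at hmin
  have hychart : y ∈ (chartAt H x).source := by rwa [extChartAt_source] at hy
  have hev : ∀ᶠ e in 𝓝 (extChartAt I x y), ContDiffAt ℝ 1 h e := hC.eventually (by simp)
  have hcont : ContinuousAt (extChartAt I x) y := continuousAt_extChartAt' hy
  have hsrc : ∀ᶠ y' in 𝓝 y, y' ∈ (extChartAt I x).source := extChartAt_source_mem_nhds' hy
  have hsm : ∀ᶠ y' in 𝓝 y, ContMDiffAt I 𝓘(ℝ, ℝ) 1 (h ∘ extChartAt I x) y' := by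
    filter_upwards [hcont.eventually hev, hsrc] with y' h1 h2
    refine ContMDiffAt.comp y' h1.contMDiffAt ?_
    exact (contMDiffAt_extChartAt' (n := ∞) (by rwa [extChartAt_source] at h2)).of_le (by simp)
  obtain ⟨g, hg, hgh⟩ := exists_contMDiff_eventuallyEq hsm
  refine ⟨g, hg, ?_, ?_⟩
  · rw [hgh.mfderiv_eq, mfderiv_comp (I' := 𝓘(ℝ, E)) y
      (hC.differentiableAt one_ne_zero).mdifferentiableAt (mdifferentiableAt_extChartAt hychart),
      mfderiv_eq_fderiv]
    rfl
  · have := hcont.eventually hmin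
    filter_upwards [this, hsrc, hgh] with y' h1 h2 h3
    simp only [Function.comp_apply, (extChartAt I x).left_inv h2, (extChartAt I x).left_inv hy]
      at h1
    rw [h3, hgh.self_of_nhds]
    exact h1

/-- Convergence in the cotangent bundle is tested in the trivialization at `x`. There a covector
pulled back through the chart at `x` is represented by `ξ` itself, whatever its base point. -/
theorem trivializationAt_toCotangentBundle {x y : M} (hy : y ∈ (chartAt H x).source)
    (ξ : E →L[ℝ] ℝ) :
    (trivializationAt (E →L[ℝ] ℝ) (fun y : M => TangentSpace I y →L[ℝ] ℝ) x
      (toCotangentBundle I y (ξ.comp (mfderiv I 𝓘(ℝ, E) (extChartAt I x) y)))).2 = ξ := by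
  ext v
  change ((trivializationAt ℝ (Bundle.Trivial M ℝ) x).continuousLinearMapAt ℝ y)
    (ξ (mfderiv I 𝓘(ℝ, E) (extChartAt I x) y
      ((trivializationAt E (TangentSpace I) x).symmL ℝ y v))) = _
  have h := congrArg (fun T : E →L[ℝ] E => T v)
    (mfderiv_extChartAt_comp_mfderivWithin_extChartAt_symm' (I := I) (x := x) (y := y)
      (by rwa [extChartAt_source]))
  have h' : mfderiv I 𝓘(ℝ, E) (extChartAt I x) y
      ((trivializationAt E (TangentSpace I) x).symmL ℝ y v) = v :=
    (congrArg (fun T : E →L[ℝ] TangentSpace I y => mfderiv I 𝓘(ℝ, E) (extChartAt I x) y (T v))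
      (TangentBundle.symmL_trivializationAt hy)).trans h
  refine (congrArg (fun w : E =>
    ((trivializationAt ℝ (Bundle.Trivial M ℝ) x).continuousLinearMapAt ℝ y) (ξ w)) h').trans ?_
  simp

/-- Chart subgradients pull back to Fréchet subgradients, whose representatives in the
trivialization at `x` are the original covectors. Continuity of `f` makes the convergence of values
automatic. -/
theorem limitingSubdiff_of_locSubgrad [I.Boundaryless] [FiniteDimensional ℝ E] [T2Space M] {f : M → ℝ} {x : M}
    (hf : ContinuousAt f x) {a : E →L[ℝ] ℝ}
    (h : ∀ ε > 0, ∃ e, dist e (extChartAt I x x) < ε ∧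
      ∃ ξ ∈ locSubgrad (f ∘ (extChartAt I x).symm) univ e, ‖ξ - a‖ < ε) :
    (a : Cotangent I x) ∈ limitingSubdiff I f x := by
  obtain ⟨δ, hδ, hball⟩ := Metric.isOpen_iff.1 (isOpen_extChartAt_target (I := I) x) _
    (mem_extChartAt_target x)
  have key := fun N : ℕ => h (min δ (1 / ((N : ℝ) + 1))) (lt_min hδ Nat.one_div_pos_of_nat)
  choose e he ξ hξ hξa using key
  have hε0 : Tendsto (fun N : ℕ => 1 / ((N : ℝ) + 1)) atTop (𝓝 0) :=
    tendsto_one_div_add_atTop_nhds_zero_nat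
  have het : ∀ N, e N ∈ (extChartAt I x).target := fun N =>
    hball ((he N).trans_le (min_le_left _ _))
  have te : Tendsto e atTop (𝓝 (extChartAt I x x)) :=
    tendsto_iff_dist_tendsto_zero.2 (squeeze_zero (fun _ => dist_nonneg)
      (fun N => ((he N).trans_le (min_le_right _ _)).le) hε0)
  have tξ : Tendsto ξ atTop (𝓝 a) :=
    tendsto_iff_norm_sub_tendsto_zero.2 (squeeze_zero (fun _ => norm_nonneg _)
      (fun N => ((hξa N).trans_le (min_le_right _ _)).le) hε0)
  have ty : Tendsto (fun N => (extChartAt I x).symm (e N)) atTop (𝓝 x) := by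
    have := (continuousAt_extChartAt_symm (I := I) x).tendsto.comp te
    rwa [extChartAt_to_inv] at this
  have hsrc : ∀ N, (extChartAt I x).symm (e N) ∈ (extChartAt I x).source := fun N =>
    (extChartAt I x).map_target (het N)
  refine ⟨fun N => (extChartAt I x).symm (e N), fun N => (ξ N).comp
    (mfderiv I 𝓘(ℝ, E) (extChartAt I x) ((extChartAt I x).symm (e N))), fun N => ?_, ty,
    hf.tendsto.comp ty, ?_⟩
  · refine frechetSubdiff_of_locSubgrad (hsrc N) ?_
    rw [(extChartAt I x).right_inv (het N)]
    exact hξ N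
  · have hsrc' : ∀ N, (extChartAt I x).symm (e N) ∈ (chartAt H x).source := fun N => by
      have := hsrc N
      rwa [extChartAt_source] at this
    rw [(trivializationAt (E →L[ℝ] ℝ) (fun y : M => TangentSpace I y →L[ℝ] ℝ) x).tendsto_nhds_iff
      (FiberBundle.mem_trivializationAt_proj_source (x := toCotangentBundle I x a))]
    refine ⟨ty, ?_⟩
    have h0 : (trivializationAt (E →L[ℝ] ℝ) (fun y : M => TangentSpace I y →L[ℝ] ℝ) x
        (toCotangentBundle I x (show Cotangent I x from a))).2 = a := by
      have h1 := trivializationAt_toCotangentBundle (I := I) (mem_chart_source H x) a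
      rwa [mfderiv_extChartAt_self] at h1
    refine Tendsto.congr (fun N => (trivializationAt_toCotangentBundle (hsrc' N) (ξ N)).symm) ?_
    exact h0.symm ▸ tξ

/-- The transition map between the two charts is smooth, hence locally Lipschitz, so the estimate
moves to the preferred chart. -/
theorem lipschitzOnWith_extChartAt_of_locLipschitzAt [I.Boundaryless] {f : M → ℝ} {x : M}
    (hf : LocLipschitzAt I f x) :
    ∃ K : NNReal, ∃ s ∈ 𝓝 (extChartAt I x x),
      LipschitzOnWith K (f ∘ (extChartAt I x).symm) s := by
  obtain ⟨φ, hφ, hx, K, hK⟩ := hf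
  set T : E → E := φ.extend I ∘ (extChartAt I x).symm with hT
  have hTC : ContDiffAt ℝ 1 T (extChartAt I x x) := by
    rw [← contMDiffAt_iff_contDiffAt]
    refine ContMDiffAt.of_le (n := ∞) ?_ (by simp)
    refine ContMDiffAt.comp (I' := I) _ ?_
      (contMDiffAt_extChartAt_symm_of_mem_target x (mem_extChartAt_target x))
    rw [extChartAt_to_inv]
    exact φ.contMDiffAt_extend hφ hx
  have hTx : T (extChartAt I x x) = φ.extend I x := by simp [hT]
  have htarget : (φ.extend I).target ∈ 𝓝 (T (extChartAt I x x)) := by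
    rw [hTx]
    exact φ.isOpen_extend_target.mem_nhds ((φ.extend I).map_source (by rwa [φ.extend_source]))
  obtain ⟨K', s, hs, hK'⟩ := lipschitzOnWith_comp_of_contDiffAt ⟨K, _, htarget, hK⟩ hTC
  have hev : ∀ᶠ e in 𝓝 (extChartAt I x x), (extChartAt I x).symm e ∈ φ.source := by
    refine (continuousAt_extChartAt_symm x).eventually ?_
    rw [extChartAt_to_inv]
    exact φ.open_source.mem_nhds hx
  refine ⟨K', s ∩ {e | (extChartAt I x).symm e ∈ φ.source}, inter_mem hs hev, ?_⟩
  have hcongr : EqOn (f ∘ (extChartAt I x).symm) ((f ∘ (φ.extend I).symm) ∘ T)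
      (s ∩ {e | (extChartAt I x).symm e ∈ φ.source}) := by
    intro e he
    have he2 : (extChartAt I x).symm e ∈ φ.source := he.2
    simp only [Function.comp_apply, hT]
    rw [φ.extend_left_inv he2]
  intro e he e' he'
  rw [hcongr he, hcongr he']
  exact hK' he.1 he'.1

theorem continuousAt_of_locLipschitzAt [I.Boundaryless] {f : M → ℝ} {x : M}
    (hf : LocLipschitzAt I f x) : ContinuousAt f x := by
  obtain ⟨K, s, hs, hK⟩ := lipschitzOnWith_extChartAt_of_locLipschitzAt hf
  have h1 : ContinuousAt (f ∘ (extChartAt I x).symm) (extChartAt I x x) :=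
    hK.continuousOn.continuousAt hs
  have h2 := ContinuousAt.comp (f := extChartAt I x) (x := x) h1 (continuousAt_extChartAt x)
  refine h2.congr ?_
  filter_upwards [extChartAt_source_mem_nhds (I := I) x] with y hy
  simp only [Function.comp_apply, (extChartAt I x).left_inv hy]

omit [IsManifold I ∞ M] in
/-- The chart at a point of an immersed manifold extends to a smooth map of the ambient space. -/
theorem exists_extension_extChartAt_of_isImmersionAt [I.Boundaryless] {W : Type*} [NormedAddCommGroup W]
    [NormedSpace ℝ W] {ι : M → W} {u : M} (h : Manifold.IsImmersionAt I 𝓘(ℝ, W) ∞ ι u) :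
    ∃ σ : W → E, ContDiffAt ℝ 1 σ (ι u) ∧ ∀ᶠ v in 𝓝 u, σ (ι v) = extChartAt I u v := by
  -- In charts adapted to the immersion, `ι` is `v ↦ (v, 0)` up to a linear equivalence. Dropping
  -- the second component gives a left inverse of `ι` that is smooth on an ambient neighbourhood.
  set ρ : W → M := fun w => (h.domChart.extend I).symm (h.equiv.symm (h.codChart.extend 𝓘(ℝ, W) w)).1
    with hρ
  have hρι : ∀ v ∈ h.domChart.source, ρ (ι v) = v := by
    intro v hv
    have hv' : v ∈ (h.domChart.extend I).source := by rwa [h.domChart.extend_source]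
    have h1 := h.writtenInCharts ((h.domChart.extend I).map_source hv')
    simp only [Function.comp_apply, (h.domChart.extend I).left_inv hv'] at h1
    simp only [hρ, h1, ContinuousLinearEquiv.symm_apply_apply, (h.domChart.extend I).left_inv hv']
  have hu := h.mem_domChart_source
  have hu' : u ∈ (h.domChart.extend I).source := by rwa [h.domChart.extend_source]
  have h1 := h.writtenInCharts ((h.domChart.extend I).map_source hu')
  simp only [Function.comp_apply, (h.domChart.extend I).left_inv hu'] at h1
  have hρC : ContMDiffAt 𝓘(ℝ, W) I ∞ ρ (ι u) := by
    have c1 : ContMDiffAt 𝓘(ℝ, W) 𝓘(ℝ, W) ∞ (h.codChart.extend 𝓘(ℝ, W)) (ι u) :=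
      h.codChart.contMDiffAt_extend h.codChart_mem_maximalAtlas h.mem_codChart_source
    have c2 : ContMDiffAt 𝓘(ℝ, W) 𝓘(ℝ, E) ∞
        (fun w => (h.equiv.symm (h.codChart.extend 𝓘(ℝ, W) w)).1) (ι u) := by
      have : ContDiff ℝ ∞ fun w => (h.equiv.symm w).1 := contDiff_fst.comp h.equiv.symm.contDiff
      exact this.contMDiff.contMDiffAt.comp (ι u) c1
    refine ContMDiffAt.comp (I' := 𝓘(ℝ, E)) (ι u) ?_ c2
    simp only [h1, ContinuousLinearEquiv.symm_apply_apply]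
    refine (contMDiffOn_extend_symm h.domChart_mem_maximalAtlas).contMDiffAt ?_
    rw [← h.domChart.extend_target']
    exact h.domChart.isOpen_extend_target.mem_nhds ((h.domChart.extend I).map_source hu')
  refine ⟨extChartAt I u ∘ ρ, ?_, ?_⟩
  · rw [← contMDiffAt_iff_contDiffAt]
    refine ContMDiffAt.of_le (n := ∞) ?_ (by simp)
    refine ContMDiffAt.comp (I' := I) _ ?_ hρC
    rw [hρι u hu]
    exact contMDiffAt_extChartAt
  · filter_upwards [h.domChart.open_source.mem_nhds hu] with v hv
    simp [hρι v hv]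

end Manifold

/-! ### Compact pieces of an embedded control set -/

section Embedding

/-- The image `ι '' S` need not be closed in `W`. As `ι` is an embedding, points with image near `ι
u` lie in a compact neighbourhood `K` of `u`, so near `ι u` the set agrees with the compact image of
`K ∩ S`. -/
theorem exists_isCompact_image_inter_closedBall {U W : Type*} [TopologicalSpace U]
    [LocallyCompactSpace U] [MetricSpace W] {ι : U → W} (hι : Topology.IsEmbedding ι) {S : Set U}
    (hS : IsClosed S) {u : U} {O : Set U} (hO : O ∈ 𝓝 u) :
    ∃ r > 0, (∀ v, ι v ∈ Metric.closedBall (ι u) r → v ∈ O) ∧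
      IsCompact (ι '' S ∩ Metric.closedBall (ι u) r) := by
  obtain ⟨K, hK, hKO, hKc⟩ := local_compact_nhds hO
  obtain ⟨r, hr, hrK⟩ : ∃ r > 0, ∀ v, ι v ∈ Metric.closedBall (ι u) r → v ∈ K := by
    rw [hι.nhds_eq_comap] at hK
    obtain ⟨r, hr, h⟩ := (Metric.nhds_basis_closedBall.comap ι).mem_iff.1 hK
    exact ⟨r, hr, fun v hv => h hv⟩
  refine ⟨r, hr, fun v hv => hKO (hrK v hv), ?_⟩
  have : ι '' S ∩ Metric.closedBall (ι u) r = ι '' (K ∩ S) ∩ Metric.closedBall (ι u) r := by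
    ext w
    constructor
    · rintro ⟨⟨v, hv, rfl⟩, hw⟩
      exact ⟨⟨v, ⟨hrK v hw, hv⟩, rfl⟩, hw⟩
    · rintro ⟨⟨v, hv, rfl⟩, hw⟩
      exact ⟨⟨v, hv.2, rfl⟩, hw⟩
  rw [this]
  exact ((hKc.inter_right hS).image hι.continuous).inter_right Metric.isClosed_closedBall

end Embedding

/-! ### Fibre derivatives in charts -/

section FibreDerivative

variable {E : Type*} [NormedAddCommGroup E] [NormedSpace ℝ E]
  {H : Type*} [TopologicalSpace H] {I : ModelWithCorners ℝ E H}
  {M : Type*} [TopologicalSpace M] [ChartedSpace H M] [IsManifold I ∞ M]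

omit [IsManifold I ∞ M] in
-- The base point is given by an equation because the curve in `fibreDeriv` starts at `Φ(v + 0 w)`,
-- while the chart is taken at a prescribed point `x`.
theorem mfderiv_curve_one_eq {c : ℝ → M} {x : M} (hx : c 0 = x)
    (hc : MDifferentiableAt 𝓘(ℝ, ℝ) I c 0) {w : E}
    (hw : HasDerivAt (fun t => extChartAt I x (c t)) w 0) :
    (mfderiv 𝓘(ℝ, ℝ) I c 0 : ℝ →L[ℝ] E) (1 : ℝ) = w := by
  subst hx
  have h1 : (mfderiv 𝓘(ℝ, ℝ) I c 0 : ℝ →L[ℝ] E) =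
      fderiv ℝ (fun t => extChartAt I (c 0) (c t)) 0 := by
    rw [hc.mfderiv]
    simp only [writtenInExtChartAt, mfld_simps, fderivWithin_univ]
    rfl
  refine (congrArg (fun T : ℝ →L[ℝ] E => T 1) (h1.trans hw.hasFDerivAt.fderiv)).trans ?_
  simp

variable {EQ : Type*} [NormedAddCommGroup EQ] [NormedSpace ℝ EQ]
  {HQ : Type*} [TopologicalSpace HQ] {J : ModelWithCorners ℝ EQ HQ}
  {Q : Type*} [TopologicalSpace Q] [ChartedSpace HQ Q] [IsManifold J ∞ Q]
  {V : Type*} [NormedAddCommGroup V] [NormedSpace ℝ V]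
  {X : Q → Type*} [TopologicalSpace (Bundle.TotalSpace V X)]
  [∀ q, AddCommGroup (X q)] [∀ q, Module ℝ (X q)] [∀ q, TopologicalSpace (X q)]
  [FiberBundle V X] [VectorBundle ℝ V X] [ContMDiffVectorBundle ∞ V X J]

omit [IsManifold I ∞ M] [IsManifold J ∞ Q] in
-- A trivialization identifies the fibre with `V`, on which `Φ` is an ordinary `C^1` map whose
-- derivative is linear. The fibre `X q` carries no norm, so `D` is only an algebraic linear map.
theorem exists_linear_eq_fibreDeriv {Φ : Bundle.TotalSpace V X → M}
    (hΦ : ContMDiff (J.prod 𝓘(ℝ, V)) I 1 Φ) {q : Q} (v : X q) {x : M} (hx : Φ ⟨q, v⟩ = x) :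
    ∃ D : X q →ₗ[ℝ] E, ∀ w, HasDerivAt (fun t : ℝ => extChartAt I x (Φ ⟨q, v + t • w⟩)) (D w) 0 ∧
      (fibreDeriv I Φ v w : E) = D w := by
  set e := trivializationAt V X q with he
  have hq : q ∈ e.baseSet := FiberBundle.mem_baseSet_trivializationAt' q
  set Λ : X q →ₗ[ℝ] V := IsLinearMap.mk' _ (e.linear ℝ hq) with hΛ
  have hsymm : ∀ y : X q, e.toOpenPartialHomeomorph.symm (q, Λ y) = ⟨q, y⟩ := fun y =>
    e.symm_apply_mk_proj (x := ⟨q, y⟩) (by rwa [e.mem_source])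
  have hmem : ∀ y : V, (q, y) ∈ e.target := fun y => e.mem_target.2 hq
  have hsm : ∀ y : V, ContMDiffAt 𝓘(ℝ, V) I 1
      (fun y => Φ (e.toOpenPartialHomeomorph.symm (q, y))) y := by
    intro y
    have h1 : ContMDiffAt (J.prod 𝓘(ℝ, V)) (J.prod 𝓘(ℝ, V)) 1 e.toOpenPartialHomeomorph.symm
        (q, y) :=
      ((e.contMDiffOn_symm (n := ∞) (IB := J)).contMDiffAt
        (e.open_target.mem_nhds (hmem y))).of_le (by simp)
    have h2 : ContMDiffAt 𝓘(ℝ, V) (J.prod 𝓘(ℝ, V)) 1 (fun y : V => (q, y)) y :=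
      contMDiffAt_const.prodMk contMDiffAt_id
    exact hΦ.contMDiffAt.comp y (h1.comp y h2)
  set γ : V → E := fun y => extChartAt I x (Φ (e.toOpenPartialHomeomorph.symm (q, y))) with hγ
  have hγd : DifferentiableAt ℝ γ (Λ v) := by
    have h1 : ContMDiffAt 𝓘(ℝ, V) 𝓘(ℝ, E) 1 γ (Λ v) := by
      refine ContMDiffAt.comp (I' := I) _ ?_ (hsm (Λ v))
      rw [hsymm, hx]
      exact contMDiffAt_extChartAt
    exact (contMDiffAt_iff_contDiffAt.1 h1).differentiableAt one_ne_zero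
  have hcurve : ∀ (w : X q) (t : ℝ), Φ ⟨q, v + t • w⟩ =
      Φ (e.toOpenPartialHomeomorph.symm (q, Λ v + t • Λ w)) := fun w t => by
    rw [← map_smul, ← map_add, hsymm]
  refine ⟨(fderiv ℝ γ (Λ v)).toLinearMap ∘ₗ Λ, fun w => ?_⟩
  have hd : HasDerivAt (fun t : ℝ => extChartAt I x (Φ ⟨q, v + t • w⟩))
      (((fderiv ℝ γ (Λ v)).toLinearMap ∘ₗ Λ) w) 0 := by
    simp only [hcurve]
    exact hγd.hasFDerivAt.hasLineDerivAt (Λ w)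
  refine ⟨hd, mfderiv_curve_one_eq (by rw [zero_smul, add_zero, hx]) ?_ hd⟩
  simp only [hcurve]
  refine (ContMDiffAt.mdifferentiableAt ?_ one_ne_zero)
  refine ContMDiffAt.comp (I' := 𝓘(ℝ, V))
    (g := fun y => Φ (e.toOpenPartialHomeomorph.symm (q, y))) (f := fun t : ℝ => Λ v + t • Λ w)
    (0 : ℝ) (hsm _) ?_
  exact (contDiff_const.add (contDiff_id.smul contDiff_const)).contMDiff.contMDiffAt

end FibreDerivative

section Covectors

variable {E : Type*} [NormedAddCommGroup E] [NormedSpace ℝ E]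
  {H : Type*} [TopologicalSpace H] {I : ModelWithCorners ℝ E H}
  {M : Type*} [TopologicalSpace M] [ChartedSpace H M]
  {E' : Type*} [NormedAddCommGroup E'] [NormedSpace ℝ E']
  {H' : Type*} [TopologicalSpace H'] {J : ModelWithCorners ℝ E' H'}
  {N : Type*} [TopologicalSpace N] [ChartedSpace H' N]

theorem pairCovector_eq (x : M) (y : N) (a : E →L[ℝ] ℝ) (b : E' →L[ℝ] ℝ) :
    (pairCovector I J x y a b : E × E' →L[ℝ] ℝ) =
      a.comp (ContinuousLinearMap.fst ℝ E E') + b.comp (ContinuousLinearMap.snd ℝ E E') := by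
  unfold pairCovector
  rw [mfderiv_fst, mfderiv_snd]
  rfl

theorem mfderiv_eq_fderiv_extChartAt [I.Boundaryless] {g : M → N} {x : M} {y : N} (hy : g x = y)
    (hg : MDifferentiableAt I J g x) :
    (mfderiv I J g x : E →L[ℝ] E') =
      fderiv ℝ (fun e => extChartAt J y (g ((extChartAt I x).symm e))) (extChartAt I x x) := by
  subst hy
  rw [hg.mfderiv, I.range_eq_univ, fderivWithin_univ]
  rfl

end Covectors

/-! ### From the linearized inequality to the Hamiltonian -/

section Stage

variable {E : Type*} [NormedAddCommGroup E] [NormedSpace ℝ E]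
  {H : Type*} [TopologicalSpace H] {I : ModelWithCorners ℝ E H}
  {M : Type*} [TopologicalSpace M] [ChartedSpace H M] [IsManifold I ∞ M]
  {EQ : Type*} [NormedAddCommGroup EQ] [NormedSpace ℝ EQ]
  {HQ : Type*} [TopologicalSpace HQ] {J : ModelWithCorners ℝ EQ HQ}
  {Q : Type*} [TopologicalSpace Q] [ChartedSpace HQ Q] [IsManifold J ∞ Q]
  {W : Type*} [NormedAddCommGroup W] [NormedSpace ℝ W]

omit [IsManifold I ∞ M] [IsManifold J ∞ Q] in
/-- If the derivative of the update map satisfies the linearized inequality for controls near `u`,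
then `u` maximizes the Hamiltonian over the whole control set. -/
theorem isMaxOn_fibrePullback_sub {V : Type*} [NormedAddCommGroup V] [NormedSpace ℝ V]
    {X : Q → Type*} [TopologicalSpace (Bundle.TotalSpace V X)]
    [∀ q, AddCommGroup (X q)] [∀ q, Module ℝ (X q)] [∀ q, TopologicalSpace (X q)]
    [FiberBundle V X] [VectorBundle ℝ V X] [ContMDiffVectorBundle ∞ V X J]
    {Φ : Bundle.TotalSpace V X → M} (hΦ : ContMDiff (J.prod 𝓘(ℝ, V)) I 1 Φ) {q : Q}
    {U : Type*} {ι : U → W} {S : Set U} (hS : Convex ℝ (ι '' S)) {f : U → X q}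
    (hf : AffineOnVia ι S f) {g : U → ℝ} (hg : ConvexOnVia ι S g) {u : U} (hu : u ∈ S) {x : M}
    (hx : Φ ⟨q, f u⟩ = x) {r : ℝ} (hr : 0 < r) {G : W → E} {D : W →L[ℝ] E}
    (hG : ∀ v, ι v ∈ Metric.closedBall (ι u) r → G (ι v) = extChartAt I x (Φ ⟨q, f v⟩))
    (hD : HasFDerivAt G D (ι u)) {p : E →L[ℝ] ℝ}
    (hp : ∀ v ∈ S, ι v ∈ Metric.closedBall (ι u) r → p (D (ι v - ι u)) ≤ g v - g u) :
    IsMaxOn (fun w => fibrePullback I Φ (f u) p (f w) - g w) S u := by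
  obtain ⟨Λ, hΛ⟩ := exists_linear_eq_fibreDeriv hΦ (f u) hx
  have hval : ∀ w, fibrePullback I Φ (f u) p (f w) = p (Λ (f w)) := fun w =>
    congrArg p (hΛ (f w)).2
  intro w hw
  have key : ∀ t : ℝ, ι u + t • (ι w - ι u) = (1 - t) • ι u + t • ι w := fun t => by module
  -- Convexity of `ι '' S` provides a control over each point of the segment from `ι u` to `ι w`;
  -- for small `t` it lies in the ball where the linearized inequality is available.
  have hsmall : ∀ᶠ t : ℝ in 𝓝[>] 0, ∃ v ∈ S, ι v = ι u + t • (ι w - ι u) ∧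
      ι v ∈ Metric.closedBall (ι u) r ∧ f v = f u + t • (f w - f u) ∧
      g v ≤ g u + t * (g w - g u) ∧ 0 < t := by
    filter_upwards [nhdsWithin_le_nhds (eventually_lt_nhds (zero_lt_one' ℝ)), self_mem_nhdsWithin,
      (tendsto_add_smul_nhdsGT (ι u) (ι w - ι u)).eventually (Metric.closedBall_mem_nhds _ hr)]
      with t ht1 ht0 hball
    have ht0 : 0 < t := ht0
    obtain ⟨v, hv, hιv⟩ := hS (mem_image_of_mem ι hu) (mem_image_of_mem ι hw)
      (sub_nonneg.2 ht1.le) ht0.le (by ring)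
    refine ⟨v, hv, by rw [hιv, key], by rw [hιv, ← key]; exact hball, ?_, ?_, ht0⟩
    · rw [hf u hu w hw v hv (1 - t) t (sub_nonneg.2 ht1.le) ht0.le (by ring) hιv]
      module
    · have := hg u hu w hw v hv (1 - t) t (sub_nonneg.2 ht1.le) ht0.le (by ring) hιv
      linarith
  -- Since `f` is affine, `G` along the ambient segment agrees with `Φ` along the fibre segment.
  -- This holds only for small `t ≥ 0`, so one-sided derivatives are compared.
  have hderiv : D (ι w - ι u) = Λ (f w - f u) := by
    have h1 : HasDerivWithinAt (fun t : ℝ => G (ι u + t • (ι w - ι u))) (D (ι w - ι u))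
        (Ioi 0) 0 := HasDerivAt.hasDerivWithinAt (hD.hasLineDerivAt (ι w - ι u))
    have h2 : HasDerivWithinAt
        (fun t : ℝ => extChartAt I x (Φ ⟨q, f u + t • (f w - f u)⟩)) (Λ (f w - f u))
        (Ioi 0) 0 := (hΛ (f w - f u)).1.hasDerivWithinAt
    refine (uniqueDiffWithinAt_Ioi 0).eq_deriv _ h1 (h2.congr_of_eventuallyEq ?_ ?_)
    · filter_upwards [hsmall] with t ht
      obtain ⟨v, -, h3, h4, h5, -⟩ := ht
      rw [← h3, ← h5]
      exact hG v h4
    · simp only [zero_smul, add_zero]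
      exact hG u (Metric.mem_closedBall_self hr.le)
  -- One small `t` suffices: the left side of the inequality is linear in `t`, the right side is at
  -- most `t * (g w - g u)`, and `t` cancels. The local inequality thus becomes global.
  obtain ⟨t, v, hv, h3, h4, -, h6, ht⟩ := hsmall.exists
  have h7 := hp v hv h4
  rw [h3, add_sub_cancel_left, map_smul, map_smul, smul_eq_mul] at h7
  have h8 : p (D (ι w - ι u)) ≤ g w - g u := le_of_mul_le_mul_left (by linarith) ht
  rw [hderiv, map_sub, map_sub] at h8
  change fibrePullback I Φ (f u) p (f w) - g w ≤ fibrePullback I Φ (f u) p (f u) - g u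
  rw [hval, hval]
  linarith

omit [IsManifold I ∞ M] in
theorem contDiffAt_extChartAt_comp [J.Boundaryless] {EU : Type*} [NormedAddCommGroup EU]
    [NormedSpace ℝ EU] {HU : Type*} [TopologicalSpace HU] {K : ModelWithCorners ℝ EU HU}
    [K.Boundaryless] {U : Type*} [TopologicalSpace U] [ChartedSpace HU U] [IsManifold K ∞ U]
    {F : Q × U → M} (hF : ContMDiff (J.prod K) I 1 F) {q : Q} {u : U} {x : M} (hx : F (q, u) = x)
    {σ : W → EU} {w : W} (hσ : ContDiffAt ℝ 1 σ w) (hσw : σ w = extChartAt K u u) :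
    ContDiffAt ℝ 1 (fun y : EQ × W => extChartAt I x
      (F ((extChartAt J q).symm y.1, (extChartAt K u).symm (σ y.2)))) (extChartAt J q q, w) := by
  rw [← contMDiffAt_iff_contDiffAt]
  have h1 : ContMDiffAt 𝓘(ℝ, EQ × W) J 1 (fun y : EQ × W => (extChartAt J q).symm y.1)
      (extChartAt J q q, w) :=
    ((contMDiffAt_extChartAt_symm_of_mem_target q (mem_extChartAt_target q)).of_le (by simp)).comp
      (extChartAt J q q, w) contDiffAt_fst.contMDiffAt
  have h2 : ContMDiffAt 𝓘(ℝ, EQ × W) K 1 (fun y : EQ × W => (extChartAt K u).symm (σ y.2))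
      (extChartAt J q q, w) := by
    refine ContMDiffAt.comp (I' := 𝓘(ℝ, EU)) (g := (extChartAt K u).symm)
      (f := fun y : EQ × W => σ y.2) (extChartAt J q q, w) ?_ ?_
    · simp only [hσw]
      exact (contMDiffAt_extChartAt_symm_of_mem_target u (mem_extChartAt_target u)).of_le (by simp)
    · exact ContDiffAt.contMDiffAt (ContDiffAt.comp (extChartAt J q q, w) hσ contDiffAt_snd)
  have h3 : ContMDiffAt 𝓘(ℝ, EQ × W) I 1 (fun y : EQ × W =>
      F ((extChartAt J q).symm y.1, (extChartAt K u).symm (σ y.2))) (extChartAt J q q, w) :=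
    hF.contMDiffAt.comp (extChartAt J q q, w) (h1.prodMk h2)
  refine ContMDiffAt.comp (I' := I) (g := extChartAt I x) (extChartAt J q q, w) ?_ h3
  simp only [hσw, extChartAt_to_inv, hx]
  exact contMDiffAt_extChartAt

end Stage

section Ambient

variable {E : Type*} [NormedAddCommGroup E] [NormedSpace ℝ E]
  {H : Type*} [TopologicalSpace H] {I : ModelWithCorners ℝ E H} [I.Boundaryless]
  {U : Type*} [TopologicalSpace U] [ChartedSpace H U] [IsManifold I ∞ U] [LocallyCompactSpace U]
  {W : Type*} [NormedAddCommGroup W] [NormedSpace ℝ W]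

omit [IsManifold I ∞ U] in
theorem exists_ambient_coordinates {ι : U → W} (hι : Manifold.IsSmoothEmbedding I 𝓘(ℝ, W) ∞ ι)
    {S : Set U} (hS : IsClosed S) (u : U) :
    ∃ (σ : W → E) (r : ℝ), 0 < r ∧ IsCompact (ι '' S ∩ Metric.closedBall (ι u) r) ∧
      ContDiffAt ℝ 1 σ (ι u) ∧ ∀ v, ι v ∈ Metric.closedBall (ι u) r →
        v ∈ (extChartAt I u).source ∧ σ (ι v) = extChartAt I u v ∧ ContinuousAt σ (ι v) := by
  obtain ⟨σ, hσ, hσι⟩ := exists_extension_extChartAt_of_isImmersionAt (hι.isImmersion.isImmersionAt u)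
  have h1 : ∀ᶠ v in 𝓝 u, ContinuousAt σ (ι v) :=
    (hι.isEmbedding.continuous.tendsto u).eventually
      ((hσ.eventually (by simp)).mono fun _ h => h.continuousAt)
  have h2 : ∀ᶠ v in 𝓝 u, v ∈ (extChartAt I u).source := extChartAt_source_mem_nhds u
  obtain ⟨r, hr, hO, hc⟩ := exists_isCompact_image_inter_closedBall hι.isEmbedding hS
    (h2.and (hσι.and h1))
  exact ⟨σ, r, hr, hc, hσ, hO⟩

end Ambient

end DiscretePMP

/-! ### Assembly of the maximum principle -/

theorem mainTheorem4
    {n d : ℕ} {m k : Fin n → ℕ}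
    -- the state manifold
    {Q : Type*} [TopologicalSpace Q] [T2Space Q] [SecondCountableTopology Q]
    [ChartedSpace (EuclideanSpace ℝ (Fin d)) Q] [IsManifold (𝓡 d) ∞ Q]
    -- the control manifolds, which are submanifolds of Euclidean spaces through `ι`
    {U : Fin n → Type*} [∀ i, TopologicalSpace (U i)]
    [∀ i, ChartedSpace (EuclideanSpace ℝ (Fin (m i))) (U i)] [∀ i, IsManifold (𝓡 (m i)) ∞ (U i)]
    (ι : ∀ i, U i → EuclideanSpace ℝ (Fin (k i)))
    (hι : ∀ i, Manifold.IsSmoothEmbedding (𝓡 (m i)) (𝓡 (k i)) ∞ (ι i))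
    -- the closed convex control sets
    (S : ∀ i, Set (U i)) (hSclosed : ∀ i, IsClosed (S i))
    (hSconvex : ∀ i, Convex ℝ (ι i '' S i))
    -- the update maps and the cost
    (F : ∀ i, Q × U i → Q) (hF : ∀ i, ContMDiff ((𝓡 d).prod (𝓡 (m i))) (𝓡 d) 1 (F i))
    (ℓ : Q → ℝ) (hℓ : DiscretePMP.LocLipschitz (𝓡 d) ℓ)
    (L : ∀ i, Q × U i → ℝ) (hL : ∀ i, DiscretePMP.LocLipschitz ((𝓡 d).prod (𝓡 (m i))) (L i))
    (hLconvex : ∀ i q, DiscretePMP.ConvexOnVia (ι i) (S i) (fun w => L i (q, w)))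
    -- the vector bundle `X → Q`, the map `Φ : X → Q` and the factorization of the update maps
    {V : Type*} [NormedAddCommGroup V] [NormedSpace ℝ V] [FiniteDimensional ℝ V]
    {X : Q → Type*} [TopologicalSpace (Bundle.TotalSpace V X)]
    [∀ q, AddCommGroup (X q)] [∀ q, Module ℝ (X q)] [∀ q, TopologicalSpace (X q)]
    [FiberBundle V X] [VectorBundle ℝ V X] [ContMDiffVectorBundle ∞ V X (𝓡 d)]
    (Φ : Bundle.TotalSpace V X → Q) (hΦ : ContMDiff ((𝓡 d).prod 𝓘(ℝ, V)) (𝓡 d) 1 Φ)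
    (f : ∀ (i : Fin n) (q : Q), U i → X q)
    (hfactor : ∀ i q w, F i (q, w) = Φ ⟨q, f i q w⟩)
    (hfaffine : ∀ i q, DiscretePMP.AffineOnVia (ι i) (S i) (f i q))
    -- the local minimizer and its state sequence
    (q₀ : Q) (u : ∀ i, U i) (hu : u ∈ DiscretePMP.admissible S)
    (hmin : IsLocalMinOn (DiscretePMP.cost F q₀ ℓ L) (DiscretePMP.admissible S) u)
    (q : Fin (n + 1) → Q) (hq : q = DiscretePMP.stateSeq F q₀ u) :
    -- the entries `a 0` and `p 0` are not used
    ∃ (a p : ∀ i : Fin (n + 1), DiscretePMP.Cotangent (𝓡 d) (q i))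
      (b : ∀ i : Fin n, DiscretePMP.Cotangent (𝓡 (m i)) (u i)),
      a (Fin.last n) ∈ DiscretePMP.limitingSubdiff (𝓡 d) ℓ (q (Fin.last n)) ∧
      (∀ i : Fin n, (i : ℕ) = 0 →
        b i ∈ DiscretePMP.limitingSubdiff (𝓡 (m i)) (fun w => L i (q₀, w)) (u i)) ∧
      (∀ i : Fin n, (i : ℕ) ≠ 0 →
        DiscretePMP.pairCovector (𝓡 d) (𝓡 (m i)) (q i.castSucc) (u i) (a i.castSucc) (b i) ∈
          DiscretePMP.limitingSubdiff ((𝓡 d).prod (𝓡 (m i))) (L i) (q i.castSucc, u i)) ∧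
      p (Fin.last n) = -a (Fin.last n) ∧
      (∀ i : Fin n, (i : ℕ) ≠ 0 →
        p i.castSucc = -a i.castSucc +
          ContinuousLinearMap.comp (p i.succ)
            (mfderiv (𝓡 d) (𝓡 d) (fun r => F i (r, u i)) (q i.castSucc))) ∧
      (∀ i : Fin n,
        IsMaxOn (fun w : U i =>
          DiscretePMP.fibrePullback (𝓡 d) Φ (f i (q i.castSucc) (u i)) (p i.succ)
            (f i (q i.castSucc) w) - L i (q i.castSucc, w)) (S i) (u i)) := by
  classical
  have hlc : ∀ i, LocallyCompactSpace (U i) := fun i =>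
    ChartedSpace.locallyCompactSpace (EuclideanSpace ℝ (Fin (m i))) (U i)
  have hT2 : ∀ i, T2Space (U i) := fun i => (hι i).isEmbedding.t2Space
  choose σ r hr hAc hσ hσι using fun i =>
    DiscretePMP.exists_ambient_coordinates (hι i) (hSclosed i) (u i)
  have hq0 : q 0 = q₀ := by rw [hq]; rfl
  have hqs : ∀ i : Fin n, F i (q i.castSucc, u i) = q i.succ := fun i => by rw [hq]; rfl
  have hcost : DiscretePMP.cost F q₀ ℓ L u =
      ℓ (q (Fin.last n)) + ∑ i : Fin n, L i (q i.castSucc, u i) := by rw [hq]; rfl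
  clear hq
  -- Intersecting with the ball gives compactness, preserves convexity, and keeps the controls in
  -- the chart at `u i`.
  set A : ∀ i, Set (EuclideanSpace ℝ (Fin (k i))) := fun i =>
    ι i '' S i ∩ Metric.closedBall (ι i (u i)) (r i) with hA
  set τ : ∀ i, EuclideanSpace ℝ (Fin (k i)) → U i := fun i w =>
    (extChartAt (𝓡 (m i)) (u i)).symm (σ i w) with hτ
  have hτι : ∀ i v, ι i v ∈ Metric.closedBall (ι i (u i)) (r i) → τ i (ι i v) = v := by
    intro i v hv
    obtain ⟨h1, h2, -⟩ := hσι i v hv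
    simp only [hτ, h2]
    exact (extChartAt (𝓡 (m i)) (u i)).left_inv h1
  have hself : ∀ i, ι i (u i) ∈ Metric.closedBall (ι i (u i)) (r i) := fun i =>
    Metric.mem_closedBall_self (hr i).le
  have hσu : ∀ i, σ i (ι i (u i)) = extChartAt (𝓡 (m i)) (u i) (u i) := fun i =>
    (hσι i _ (hself i)).2.1
  set P : ∀ j, EuclideanSpace ℝ (Fin d) → Q := fun j => (extChartAt (𝓡 d) (q j)).symm with hP
  set zb : Fin (n + 1) → EuclideanSpace ℝ (Fin d) := fun j => extChartAt (𝓡 d) (q j) (q j) with hzb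
  set yb : ∀ i, EuclideanSpace ℝ (Fin (k i)) := fun i => ι i (u i) with hyb
  have hPz : ∀ j, P j (zb j) = q j := fun j => extChartAt_to_inv (q j)
  have hτy : ∀ i, τ i (yb i) = u i := fun i => hτι i _ (hself i)
  have hPc : ∀ j, ContinuousAt (P j) (zb j) := fun j => continuousAt_extChartAt_symm (q j)
  have hτc : ∀ i v, ι i v ∈ Metric.closedBall (ι i (u i)) (r i) →
      ContinuousAt (τ i) (ι i v) := by
    intro i v hv
    obtain ⟨h1, h2, h3⟩ := hσι i v hv
    refine ContinuousAt.comp (g := (extChartAt (𝓡 (m i)) (u i)).symm) (f := σ i) ?_ h3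
    rw [h2]
    exact continuousAt_extChartAt_symm' h1
  set Fc : ∀ i, EuclideanSpace ℝ (Fin d) × EuclideanSpace ℝ (Fin (k i)) → EuclideanSpace ℝ (Fin d) :=
    fun i x => extChartAt (𝓡 d) (q i.succ) (F i (P i.castSucc x.1, τ i x.2)) with hFc
  set Lt : ∀ i, EuclideanSpace ℝ (Fin d) × EuclideanSpace ℝ (Fin (m i)) → ℝ := fun i x =>
    L i (P i.castSucc x.1, (extChartAt (𝓡 (m i)) (u i)).symm x.2) with hLt
  have hcL : ∀ i x, ContinuousAt (L i) x := fun i x =>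
    DiscretePMP.continuousAt_of_locLipschitzAt (hL i x)
  have hLtchart : ∀ i : Fin n, L i ∘ (extChartAt ((𝓡 d).prod (𝓡 (m i))) (q i.castSucc, u i)).symm =
      Lt i := fun i => by
    rw [extChartAt_prod]
    rfl
  have hLtLip : ∀ i : Fin n, ∃ K : NNReal, ∃ s ∈ 𝓝 (zb i.castSucc, extChartAt (𝓡 (m i)) (u i) (u i)),
      LipschitzOnWith K (Lt i) s := by
    intro i
    have := DiscretePMP.lipschitzOnWith_extChartAt_of_locLipschitzAt (hL i (q i.castSucc, u i))
    rw [hLtchart i, extChartAt_prod] at this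
    exact this
  have hFC : ∀ i : Fin n, ContDiffAt ℝ 1 (Fc i) (zb i.castSucc, yb i) := fun i =>
    DiscretePMP.contDiffAt_extChartAt_comp (hF i) (hqs i) (hσ i) (hσu i)
  obtain ⟨p, a, hpa, hrec, hℓa, hLa, hmax⟩ := DiscretePMP.exists_costates (F := Fc)
    (ℓ := ℓ ∘ P (Fin.last n)) (L := fun i x => Lt i (x.1, σ i x.2)) (A := A) (zb := zb) (yb := yb)
    hAc (fun i => ⟨Set.mem_image_of_mem _ (hu i), hself i⟩)
    (fun i => by
      change zb i.succ =
        extChartAt (𝓡 d) (q i.succ) (F i (P i.castSucc (zb i.castSucc), τ i (yb i)))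
      rw [hPz, hτy, hqs])
    hFC
    (DiscretePMP.lipschitzOnWith_extChartAt_of_locLipschitzAt (hℓ (q (Fin.last n))))
    (by
      intro i
      refine DiscretePMP.lipschitzOnWith_comp_of_contDiffAt (g := Lt i)
        (T := fun x : EuclideanSpace ℝ (Fin d) × EuclideanSpace ℝ (Fin (k i)) => (x.1, σ i x.2))
        (y := (zb i.castSucc, yb i)) ?_ ?_
      · simp only [hyb, hσu]
        exact hLtLip i
      · exact contDiffAt_fst.prodMk
          (ContDiffAt.comp (zb i.castSucc, yb i) (hσ i) contDiffAt_snd))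
    (by
      rintro i _ ⟨⟨v, hv, rfl⟩, hvb⟩
      refine ContinuousAt.comp (g := L i) (f := fun x : EuclideanSpace ℝ (Fin d) ×
        EuclideanSpace ℝ (Fin (k i)) => (P i.castSucc x.1, τ i x.2)) (hcL i _) ?_
      exact (ContinuousAt.comp (f := Prod.fst) (x := (zb i.castSucc, ι i v)) (hPc _)
        continuousAt_fst).prodMk (ContinuousAt.comp (f := Prod.snd) (x := (zb i.castSucc, ι i v))
          (hτc i v hvb) continuousAt_snd))
    (by
      intro i
      -- The inverse chart is a total function and convexity in the control holds at every state, so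
      -- `z` need not be close to `zb`.
      refine Filter.Eventually.of_forall fun z => ⟨(hSconvex i).inter (convex_closedBall _ _), ?_⟩
      rintro _ ⟨⟨v, hv, rfl⟩, hvb⟩ _ ⟨⟨w, hw, rfl⟩, hwb⟩ s t hs ht hst
      obtain ⟨⟨x, hx, hxe⟩, hxb⟩ := ((hSconvex i).inter (convex_closedBall (ι i (u i)) (r i)))
        ⟨Set.mem_image_of_mem _ hv, hvb⟩ ⟨Set.mem_image_of_mem _ hw, hwb⟩ hs ht hst
      have h := hLconvex i (P i.castSucc z) v hv w hw x hx s t hs ht hst hxe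
      rw [← hxe] at hxb
      change L i (P i.castSucc z, τ i (s • ι i v + t • ι i w)) ≤
        s • L i (P i.castSucc z, τ i (ι i v)) + t • L i (P i.castSucc z, τ i (ι i w))
      rw [← hxe, hτι i x hxb, hτι i v hvb, hτι i w hwb]
      exact h)
    (by
      have c1 : ∀ i : Fin n, ContinuousAt (fun x : (Fin (n + 1) → EuclideanSpace ℝ (Fin d)) ×
          (∀ i, EuclideanSpace ℝ (Fin (k i))) => τ i (x.2 i)) (zb, yb) := fun i =>
        ContinuousAt.comp (g := τ i) (f := fun x : (Fin (n + 1) → EuclideanSpace ℝ (Fin d)) ×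
          (∀ i, EuclideanSpace ℝ (Fin (k i))) => x.2 i) (hτc i (u i) (hself i)) (by fun_prop)
      have c2 : ∀ j, ContinuousAt (fun x : (Fin (n + 1) → EuclideanSpace ℝ (Fin d)) ×
          (∀ i, EuclideanSpace ℝ (Fin (k i))) => P j (x.1 j)) (zb, yb) := fun j =>
        ContinuousAt.comp (g := P j) (f := fun x : (Fin (n + 1) → EuclideanSpace ℝ (Fin d)) ×
          (∀ i, EuclideanSpace ℝ (Fin (k i))) => x.1 j) (hPc j) (by fun_prop)
      -- Once the next state lies in its chart domain, the coordinate equation determines it, so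
      -- feasible points in coordinates are true trajectories.
      have e1 : ∀ᶠ x : (Fin (n + 1) → EuclideanSpace ℝ (Fin d)) ×
          (∀ i, EuclideanSpace ℝ (Fin (k i))) in 𝓝 (zb, yb), ∀ i : Fin n,
          F i (P i.castSucc (x.1 i.castSucc), τ i (x.2 i)) ∈
            (extChartAt (𝓡 d) (q i.succ)).source := by
        refine Filter.eventually_all.2 fun i => ?_
        have h1 : ContinuousAt (fun x : (Fin (n + 1) → EuclideanSpace ℝ (Fin d)) ×
          (∀ i, EuclideanSpace ℝ (Fin (k i))) =>
            F i (P i.castSucc (x.1 i.castSucc), τ i (x.2 i))) (zb, yb) :=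
          ContinuousAt.comp (g := F i) (hF i).continuous.continuousAt ((c2 _).prodMk (c1 i))
        refine h1.eventually ?_
        simp only [hPz, hτy, hqs]
        exact extChartAt_source_mem_nhds (q i.succ)
      have c3 : ContinuousAt (fun x : (Fin (n + 1) → EuclideanSpace ℝ (Fin d)) ×
          (∀ i, EuclideanSpace ℝ (Fin (k i))) => fun i => τ i (x.2 i)) (zb, yb) :=
        continuousAt_pi.2 c1
      have e2 := c3.eventually (p := fun v => v ∈ DiscretePMP.admissible S →
        DiscretePMP.cost F q₀ ℓ L u ≤ DiscretePMP.cost F q₀ ℓ L v) (by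
          simp only [hτy]
          exact eventually_nhdsWithin_iff.1 hmin)
      filter_upwards [e1, e2] with x hx1 hx2 hxA hx0 hxs
      have hadm : (fun i => τ i (x.2 i)) ∈ DiscretePMP.admissible S := by
        intro i
        obtain ⟨⟨v, hv, hve⟩, hvb⟩ := hxA i
        rw [← hve] at hvb
        change τ i (x.2 i) ∈ S i
        rw [← hve, hτι i v hvb]
        exact hv
      have hstate : ∀ j, DiscretePMP.stateSeq F q₀ (fun i => τ i (x.2 i)) j = P j (x.1 j) := by
        intro j
        induction j using Fin.induction with
        | zero =>
          rw [hx0, hPz, hq0]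
          rfl
        | succ i ih =>
          rw [DiscretePMP.stateSeq_succ, ih, hxs i]
          exact ((extChartAt (𝓡 d) (q i.succ)).left_inv (hx1 i)).symm
      have h := hx2 hadm
      rw [hcost, DiscretePMP.cost] at h
      simp only [hstate] at h
      have e3 : ∀ i : Fin n, Lt i (zb i.castSucc, σ i (yb i)) = L i (q i.castSucc, u i) := by
        intro i
        change L i (P i.castSucc (zb i.castSucc), τ i (yb i)) = _
        rw [hPz, hτy]
      simp only [e3, Function.comp_apply, hPz]
      exact h)
  have hb : ∀ i : Fin n, ∃ b : EuclideanSpace ℝ (Fin (m i)) →L[ℝ] ℝ,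
      ((i : ℕ) = 0 → (b : DiscretePMP.Cotangent (𝓡 (m i)) (u i)) ∈
        DiscretePMP.limitingSubdiff (𝓡 (m i)) (fun w => L i (q₀, w)) (u i)) ∧
      ((i : ℕ) ≠ 0 → DiscretePMP.pairCovector (𝓡 d) (𝓡 (m i)) (q i.castSucc) (u i)
        (a i.castSucc) b ∈
          DiscretePMP.limitingSubdiff ((𝓡 d).prod (𝓡 (m i))) (L i) (q i.castSucc, u i)) := by
    intro i
    by_cases hi : (i : ℕ) = 0
    -- At stage `0` the state is fixed and `b 0` is not tied to any costate, so every limiting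
    -- subgradient of the partial function will do.
    · have hLip := DiscretePMP.lipschitzOnWith_comp_of_contDiffAt (g := Lt i)
        (T := fun x : EuclideanSpace ℝ (Fin (m i)) => (zb i.castSucc, x)) (hLtLip i)
        (contDiffAt_const.prodMk contDiffAt_id)
      obtain ⟨b, hb⟩ := DiscretePMP.exists_limit_of_locSubgrad hLip
      refine ⟨b, fun _ => ?_, fun h => absurd hi h⟩
      have hqi : q i.castSucc = q₀ := by
        rw [← hq0]
        congr 1
        exact Fin.ext hi
      refine DiscretePMP.limitingSubdiff_of_locSubgrad ?_ ?_
      · exact ContinuousAt.comp (g := L i) (hcL i _) (continuousAt_const.prodMk continuousAt_id)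
      · have hfun : (fun w => L i (q₀, w)) ∘ (extChartAt (𝓡 (m i)) (u i)).symm =
            Lt i ∘ fun x : EuclideanSpace ℝ (Fin (m i)) => (zb i.castSucc, x) := by
          ext x
          change _ = L i (P i.castSucc (zb i.castSucc), _)
          rw [hPz, hqi]
          rfl
        rw [hfun]
        exact hb
    · have hG : ContDiffAt ℝ 1 (fun x => ι i ((extChartAt (𝓡 (m i)) (u i)).symm x))
          (extChartAt (𝓡 (m i)) (u i) (u i)) := by
        rw [← contMDiffAt_iff_contDiffAt]
        refine ContMDiffAt.of_le (n := ∞) ?_ (by simp)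
        exact ((hι i).contMDiff.contMDiffAt).comp _
          (DiscretePMP.contMDiffAt_extChartAt_symm_of_mem_target (u i) (mem_extChartAt_target _))
      have hGu : ι i ((extChartAt (𝓡 (m i)) (u i)).symm (extChartAt (𝓡 (m i)) (u i) (u i))) =
          ι i (u i) := by rw [extChartAt_to_inv]
      have hballev : ∀ᶠ x in 𝓝 (extChartAt (𝓡 (m i)) (u i) (u i)),
          ι i ((extChartAt (𝓡 (m i)) (u i)).symm x) ∈ Metric.closedBall (ι i (u i)) (r i) := by
        refine hG.continuousAt.eventually ?_
        simp only [hGu]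
        exact Metric.closedBall_mem_nhds _ (hr i)
      -- At later stages only the state component `a i.castSucc` is prescribed; `b` is an
      -- accumulation point of the bounded control components.
      obtain ⟨b, hb⟩ := DiscretePMP.exists_limit_of_locSubgrad_fst (hLtLip i) (a := a i.castSucc)
        (fun ε hε => DiscretePMP.exists_locSubgrad_of_ambient (hAc i) (σ := σ i) hG
          (by rw [hGu]; exact (hσ i).continuousAt)
          (by
            filter_upwards [hballev, extChartAt_target_mem_nhds (I := 𝓡 (m i)) (u i)] with x h1 h2
            rw [(hσι i _ h1).2.1, (extChartAt (𝓡 (m i)) (u i)).right_inv h2])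
          (by
            rintro _ ⟨⟨v, hv, rfl⟩, hvb⟩
            exact congrArg (ι i) (hτι i v hvb))
          (hLtLip i) (by rw [hGu]; exact hLa i) hε)
      refine ⟨b, fun h => absurd h hi, fun _ => ?_⟩
      have := DiscretePMP.limitingSubdiff_of_locSubgrad (I := (𝓡 d).prod (𝓡 (m i)))
        (f := L i) (x := (q i.castSucc, u i)) (hcL i _)
        (a := (a i.castSucc).comp (ContinuousLinearMap.fst ℝ _ _) +
          b.comp (ContinuousLinearMap.snd ℝ _ _)) (by
          rw [hLtchart i, extChartAt_prod]
          exact hb)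
      have hpair := DiscretePMP.pairCovector_eq (I := 𝓡 d) (J := 𝓡 (m i)) (q i.castSucc) (u i)
        (a i.castSucc) b
      exact hpair ▸ this
  choose b hb0 hb1 using hb
  refine ⟨fun j => a j, fun j => p j, fun i => b i, ?_, hb0, hb1, hpa, ?_, ?_⟩
  · exact DiscretePMP.limitingSubdiff_of_locSubgrad
      (DiscretePMP.continuousAt_of_locLipschitzAt (hℓ _)) hℓa
  · intro i _
    have hdiff : MDifferentiableAt (𝓡 d) (𝓡 d) (fun r => F i (r, u i)) (q i.castSucc) :=
      ((hF i).comp (contMDiff_id.prodMk contMDiff_const)).mdifferentiable one_ne_zero _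
    have h1 := DiscretePMP.mfderiv_eq_fderiv_extChartAt (g := fun r => F i (r, u i))
      (x := q i.castSucc) (y := q i.succ) (hqs i) hdiff
    have h2 : HasFDerivAt (fun e => extChartAt (𝓡 d) (q i.succ)
        (F i ((extChartAt (𝓡 d) (q i.castSucc)).symm e, u i)))
        ((fderiv ℝ (Fc i) (zb i.castSucc, yb i)).comp (ContinuousLinearMap.inl ℝ _ _))
        (extChartAt (𝓡 d) (q i.castSucc) (q i.castSucc)) := by
      have h3 := HasFDerivAt.comp (zb i.castSucc) (f := fun e => (e, yb i)) (g := Fc i)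
        ((hFC i).differentiableAt one_ne_zero).hasFDerivAt (hasFDerivAt_prodMk_left _ _)
      have h4 : Fc i ∘ (fun e => (e, yb i)) = fun e => extChartAt (𝓡 d) (q i.succ)
        (F i ((extChartAt (𝓡 d) (q i.castSucc)).symm e, u i)) := by
        ext1 e
        simp only [Function.comp_apply, hFc, hτy, hP]
      rwa [h4] at h3
    exact (hrec i).trans (congrArg (fun T : EuclideanSpace ℝ (Fin d) →L[ℝ] EuclideanSpace ℝ (Fin d) =>
      -a i.castSucc + (p i.succ).comp T) (h1.trans h2.fderiv).symm)
  · intro i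
    have hD : HasFDerivAt (fun w => Fc i (zb i.castSucc, w))
        ((fderiv ℝ (Fc i) (zb i.castSucc, yb i)).comp (ContinuousLinearMap.inr ℝ _ _))
        (ι i (u i)) :=
      HasFDerivAt.comp (ι i (u i)) (f := fun w => (zb i.castSucc, w)) (g := Fc i)
        ((hFC i).differentiableAt one_ne_zero).hasFDerivAt (hasFDerivAt_prodMk_right _ _)
    exact DiscretePMP.isMaxOn_fibrePullback_sub hΦ (hSconvex i) (hfaffine i (q i.castSucc))
      (hLconvex i (q i.castSucc)) (hu i) (x := q i.succ) (by rw [← hfactor, hqs]) (hr i)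
      (fun v hv => by
        change extChartAt (𝓡 d) (q i.succ) (F i (P i.castSucc (zb i.castSucc), τ i (ι i v))) = _
        rw [hPz, hτι i v hv, hfactor]) hD
      (fun v hv hvb => by
        have h := hmax i (ι i v) ⟨Set.mem_image_of_mem _ hv, hvb⟩
        have e1 : Lt i (zb i.castSucc, σ i (ι i v)) = L i (q i.castSucc, v) := by
          change L i (P i.castSucc (zb i.castSucc), τ i (ι i v)) = _
          rw [hPz, hτι i v hvb]
        have e2 : Lt i (zb i.castSucc, σ i (yb i)) = L i (q i.castSucc, u i) := by
          change L i (P i.castSucc (zb i.castSucc), τ i (yb i)) = _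
          rw [hPz, hτy]
        simp only [e1, e2] at h
        exact h)
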